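/- **Theorem.** Let $n\ge 1$, $\gamma=(\gamma_1,\dots,\gamma_n)$ with all $\gamma_i>0$, $|\gamma|=\gamma_1+\dots+\gamma_n$, $\mathbb R^n_+=\{x:\ x_i>0 \text{ for all } i\}$, $x^\gamma=\prod_i x_i^{\gamma_i}$, and $S_1^+(n)=\{y\in\mathbb R^n_+:\ |y|=1\}$ with surface measure $dS$ and $|S_1^+(n)|_\gamma=\int_{S_1^+(n)}y^\gamma\,dS(y)$. For $\nu>0$ and a function $g$ of one variable let $$ {}^{\nu}T_s^t g(s)=\frac{\Gamma(\frac{\nu+1}{2})}{\sqrt\pi\,\Gamma(\frac{\nu}{2})}\int_0^\pi g\big(\sqrt{s^2+t^2-2st\cos\varphi}\big)\sin^{\nu-1}\varphi\,d\varphi ,$$ let $T^yf(x)=\big({}^{\gamma_1}T_{x_1}^{y_1}\cdots{}^{\gamma_n}T_{x_n}^{y_n}f\big)(x)$, let $$M_r^\gamma f(x)=M_f^\gamma(x;r)=\frac1{|S_1^+(n)|_\gamma}\int_{S_1^+(n)}T^{ry}f(x)\,y^\gamma\,dS(y),$$ and let $I_f^\gamma(x;\lambda,\mu)=M_\lambda^\gamma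 M_\mu^\gamma f(x)$. Let $f$ be a real function, even in each variable, with $\int_{\mathbb R^n_+}|f(x)|\,x^\gamma dx<\infty$. Throughout, $x\in\mathbb R^n_+$ and $\lambda,\mu>0$. *(Convergence.)* For every $x$, the integrals defining $M_f^\gamma(x;r)$ converge absolutely for almost every $r>0$. The integrals defining $I_f^\gamma(x;\lambda,\mu)$ converge absolutely: for all $\lambda,\mu$ and almost every $x$; for every $x$ and $\mu$ and almost every $\lambda$; for every $x$ and $\lambda$ and almost every $\mu$; and for all $x,\lambda,\mu$ if $f$ is bounded on bounded subsets of $\mathbb R^n_+$ (for example if $f$ is continuous on $\mathbb R^n$). *(Formulas.)* For all $x,\lambda,\mu$ for which the integrals defining $I_f^\gamma(x;\lambda,\mu)$ converge absolutely, $$I_f^\gamma(x;\lambda,\mu)={}^{\nu}T_\mu^\lambda M_f^\gamma(x;\mu),\qquad \nu=n+|\gamma|-1,$$ where the one-dimensional translation acts on $r\mapsto M_f^\gamma(x;r)$ at $r=\mu$, and $$I_f^\gamma(x;\lambda,\mu)=\frac{2\Gamma(\frac{n+|\gamma|}2)}{\sqrt\pi\,\Gamma(\frac{n+|\gamma|-1}2)}\frac1{(2\lambda\mu)^{n+|\gamma|-2}}\int_{|\lambda-\mu|}^{\lambda+\mu}\Big(\big(\lambda^2-(r-\mu)^2\big)\big((r+\mu)^2-\lambda^2\big)\Big)^{\frac{n+|\gamma|-3}2}M_f^\gamma(x;r)\,r\,dr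 .$$ For all $x$ and all real $\alpha,\beta$ with $|\alpha|<\beta$ for which the integrals defining $I_f^\gamma\big(x;\frac{\beta-\alpha}2,\frac{\beta+\alpha}2\big)$ converge absolutely, $$I_f^\gamma\Big(x;\frac{\beta-\alpha}2,\frac{\beta+\alpha}2\Big)=\frac{\Gamma(\frac{n+|\gamma|}2)}{\sqrt\pi\,\Gamma(\frac{n+|\gamma|-1}2)}\frac{2^{n+|\gamma|-1}}{(\beta^2-\alpha^2)^{n+|\gamma|-2}}\int_{|\alpha|}^{\beta}\big((\beta^2-r^2)(r^2-\alpha^2)\big)^{\frac{n+|\gamma|-3}2}M_f^\gamma(x;r)\,r\,dr .$$ In both formulas the integrand is absolutely integrable. The lower limits $|\lambda-\mu|$ and $|\alpha|$ may be replaced by $\lambda-\mu$ and $\alpha$ whenever the integrand is absolutely integrable on the larger interval; for the former this holds if $f$ is bounded on bounded subsets of $\mathbb R^n_+$. Here, for $b>0$ and real $s$, the real power of a negative number is read as $(-b)^s=b^s\cos(\pi s)$. -/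

import Mathlib

open MeasureTheory Set Filter

noncomputable section

/-- The open positive orthant `ℝ₊ⁿ`. -/
def posOrthant (n : ℕ) : Set (Fin n → ℝ) := {x | ∀ i, 0 < x i}

/-- The weight `x^γ = ∏ xᵢ^γᵢ`. -/
def powWeight {n : ℕ} (γ x : Fin n → ℝ) : ℝ := ∏ i, x i ^ γ i

/-- Evenness in every variable (the functions on the orthant are extended evenly to `ℝⁿ`). -/
def EvenInEach {n : ℕ} (f : (Fin n → ℝ) → ℝ) : Prop :=
  ∀ (i : Fin n) (x : Fin n → ℝ), f (Function.update x i (-x i)) = f x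

/-- The one-dimensional generalized translation `(^ν T_s^t g)(s)` of order `ν > 0`
of a function `g` of one variable. -/
def genTranslation (ν t : ℝ) (g : ℝ → ℝ) (s : ℝ) : ℝ :=
  Real.Gamma ((ν + 1) / 2) / (√Real.pi * Real.Gamma (ν / 2)) *
    ∫ φ in (0 : ℝ)..Real.pi,
      g √(s ^ 2 + t ^ 2 - 2 * s * t * Real.cos φ) * Real.sin φ ^ (ν - 1)

/-- The generalized translation of order `ν` by `t`, acting on `f` in the `i`-th variable. -/
def coordTranslation {n : ℕ} (i : Fin n) (ν t : ℝ) (f : (Fin n → ℝ) → ℝ)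
    (x : Fin n → ℝ) : ℝ :=
  genTranslation ν t (fun s => f (Function.update x i s)) (x i)

/-- The multidimensional generalized translation `T^y f`, the product (composition) over all
`i` of the one-dimensional translations of order `γᵢ` by `yᵢ` in the `i`-th variable. -/
def multiTranslation {n : ℕ} (γ y : Fin n → ℝ) (f : (Fin n → ℝ) → ℝ) :
    (Fin n → ℝ) → ℝ :=
  (List.finRange n).foldr (fun i g => coordTranslation i (γ i) (y i) g) f

/-- The unit sphere of Euclidean space `ℝⁿ`. -/
abbrev UnitSphere (n : ℕ) : Type := Metric.sphere (0 : EuclideanSpace ℝ (Fin n)) 1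

/-- The surface measure `dS` on the unit sphere. -/
def surfaceMeasure (n : ℕ) : Measure (UnitSphere n) :=
  (volume : Measure (EuclideanSpace ℝ (Fin n))).toSphere

/-- The part `S₁⁺(n)` of the unit sphere in the positive orthant. -/
def posSphere (n : ℕ) : Set (UnitSphere n) := {y | ∀ i, 0 < y.1 i}

/-- The coordinates of the point `r y`, for `y` on the unit sphere. -/
def scaled {n : ℕ} (r : ℝ) (y : UnitSphere n) : Fin n → ℝ := fun i => r * y.1 i

/-- The weight `y^γ` on the unit sphere. -/
def sphereWeight {n : ℕ} (γ : Fin n → ℝ) (y : UnitSphere n) : ℝ := ∏ i, y.1 i ^ γ i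

/-- The weighted area `|S₁⁺(n)|_γ`. -/
def sphereArea {n : ℕ} (γ : Fin n → ℝ) : ℝ :=
  ∫ y in posSphere n, sphereWeight γ y ∂(surfaceMeasure n)

/-- The weighted spherical mean `M_r^γ f(x) = M_f^γ(x; r)`. -/
def sphericalMean {n : ℕ} (γ : Fin n → ℝ) (r : ℝ) (f : (Fin n → ℝ) → ℝ)
    (x : Fin n → ℝ) : ℝ :=
  (1 / sphereArea γ) *
    ∫ y in posSphere n, multiTranslation γ (scaled r y) f x * sphereWeight γ y
      ∂(surfaceMeasure n)

/-- The iterated weighted spherical mean `I_f^γ(x; l, m) = M_l^γ M_m^γ f(x)`. -/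
def iteratedMean {n : ℕ} (γ : Fin n → ℝ) (l m : ℝ) (f : (Fin n → ℝ) → ℝ)
    (x : Fin n → ℝ) : ℝ :=
  sphericalMean γ l (sphericalMean γ m f) x

/-- The point at which `f` is evaluated under the integrals in `T^y f(x)`:
its coordinates are `√(xᵢ² + yᵢ² - 2 xᵢ yᵢ cos φᵢ)`. -/
def translatedPoint {n : ℕ} (x y φ : Fin n → ℝ) : Fin n → ℝ :=
  fun i => √(x i ^ 2 + y i ^ 2 - 2 * x i * y i * Real.cos (φ i))

/-- The domain of integration `S₁⁺(n) × (0, π)ⁿ` of a weighted spherical mean. -/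
def meanDomain (n : ℕ) : Set (UnitSphere n × (Fin n → ℝ)) :=
  posSphere n ×ˢ univ.pi fun _ => Ioo 0 Real.pi

/-- The weight `y^γ ∏ sin^(γᵢ-1) φᵢ` under the integrals of a weighted spherical mean. -/
def meanWeight {n : ℕ} (γ : Fin n → ℝ) (p : UnitSphere n × (Fin n → ℝ)) : ℝ :=
  sphereWeight γ p.1 * ∏ i, Real.sin (p.2 i) ^ (γ i - 1)

/-- The integrals in `M_f^γ(x; r)` converge absolutely. -/
def MeanConverges {n : ℕ} (γ : Fin n → ℝ) (r : ℝ) (f : (Fin n → ℝ) → ℝ)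
    (x : Fin n → ℝ) : Prop :=
  IntegrableOn
    (fun p : UnitSphere n × (Fin n → ℝ) =>
      f (translatedPoint x (scaled r p.1) p.2) * meanWeight γ p)
    (meanDomain n) ((surfaceMeasure n).prod volume)

/-- The integrals in `I_f^γ(x; l, m)` converge absolutely. -/
def IteratedMeanConverges {n : ℕ} (γ : Fin n → ℝ) (l m : ℝ) (f : (Fin n → ℝ) → ℝ)
    (x : Fin n → ℝ) : Prop :=
  IntegrableOn
    (fun p : (UnitSphere n × (Fin n → ℝ)) × (UnitSphere n × (Fin n → ℝ)) =>
      f (translatedPoint (translatedPoint x (scaled l p.1.1) p.1.2) (scaled m p.2.1) p.2.2) *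
        (meanWeight γ p.1 * meanWeight γ p.2))
    (meanDomain n ×ˢ meanDomain n)
    (((surfaceMeasure n).prod volume).prod ((surfaceMeasure n).prod volume))

/-- `n + |γ|`, where `|γ| = γ₁ + ⋯ + γₙ`. -/
def effDim {n : ℕ} (γ : Fin n → ℝ) : ℝ := n + ∑ i, γ i

/-- The integrand
`((l² - (r - m)²)((r + m)² - l²))^((n + |γ| - 3)/2) M_f^γ(x; r) r` as a function of `r`. -/
def kernelIntegrand {n : ℕ} (γ : Fin n → ℝ) (l m : ℝ) (f : (Fin n → ℝ) → ℝ)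
    (x : Fin n → ℝ) (r : ℝ) : ℝ :=
  ((l ^ 2 - (r - m) ^ 2) * ((r + m) ^ 2 - l ^ 2)) ^ ((effDim γ - 3) / 2) *
    sphericalMean γ r f x * r

/-- The integrand `((b² - r²)(r² - a²))^((n + |γ| - 3)/2) M_f^γ(x; r) r`
as a function of `r`. -/
def symmKernelIntegrand {n : ℕ} (γ : Fin n → ℝ) (a b : ℝ) (f : (Fin n → ℝ) → ℝ)
    (x : Fin n → ℝ) (r : ℝ) : ℝ :=
  ((b ^ 2 - r ^ 2) * (r ^ 2 - a ^ 2)) ^ ((effDim γ - 3) / 2) *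
    sphericalMean γ r f x * r

end

/-! With the stated constants every averaging operation is integration against a probability
measure: `angleMeasure` for one translation, `meanMeasure` for a spherical mean. Hence both sides of
the translation formula integrate `f` against the law of a random point in the orthant: the law of
`iteratedPoint` under two independent copies of `meanMeasure`, or the law of `translatedMeanPoint`,
in which the radius is itself the third side of a triangle with sides `m`, `l` and random angle. The
core of the proof is that these laws coincide, `map_iteratedPoint_eq`.

Both laws live in a box of the closed orthant, where the squares of the coordinates separate points,
so by Stone–Weierstrass it suffices to compare even moments (`measure_eq_of_even_moments`).
Normalize the even powers so that their generating series is a Bessel function. The product formula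
for that function, read coefficient by coefficient, says that a translation turns a normalized power
into a convolution over an antidiagonal (`integral_besselMonomial`). A mean over the sphere turns a
normalized monomial of multi-degree `α` into a multinomial coefficient times a normalized power of
the radius, now of order `n + |γ| - 1` (`integral_besselProd_sphere`). In terms of formal power
series, taking a mean of radius `r` is multiplication by a series `H r`; iterating gives `H l * H
m`, and by a Vandermonde identity (`sum_radialCoeff_mul`) translating the radius gives `H m * H l`.

Convergence rests on invariance: translation preserves `x^γ dx` (`map_translate_powMeasure`),
because in suitable polar coordinates it is a shift of a half-plane. Tonelli then bounds the
integral of a mean over the radius or over the centre by the integral of `|f|`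
(`lintegral_mean_radial`, `lintegral_mean_orthant`). Since `f` matters only up to Lebesgue null
sets, the laws must also be absolutely continuous (`quasiMeasurePreserving_iteratedPoint`).

The single integral arises by substituting the third side for the angle: the kernel is a power of
the squared area of the triangle. The lower limit may lose its absolute value because the integrand
is odd in `r`. -/

noncomputable section

/-! ### Product measures -/

theorem lintegral_pi_prod {E : Type*} [MeasurableSpace E] {n : ℕ} (μ : Fin n → Measure E)
    [∀ i, SigmaFinite (μ i)] (g : Fin n → E → ENNReal) (hg : ∀ i, Measurable (g i)) :
    ∫⁻ x, ∏ i, g i (x i) ∂(Measure.pi μ) = ∏ i, ∫⁻ x, g i x ∂(μ i) := by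
  induction n with
  | zero => simp
  | succ n ih =>
    have hm : Measurable fun y : Fin n → E => ∏ i : Fin n, g i.succ (y i) :=
      Finset.measurable_fun_prod _ fun i _ => (hg i.succ).comp (measurable_pi_apply i)
    rw [← (measurePreserving_piFinSuccAbove μ 0).symm.lintegral_comp_emb
      (MeasurableEquiv.measurableEmbedding _)]
    simp only [MeasurableEquiv.piFinSuccAbove_symm_apply, Fin.insertNthEquiv,
      Fin.prod_univ_succ, Fin.insertNth_zero, Equiv.coe_fn_mk, Fin.cons_succ,
      Fin.zero_succAbove, Fin.cons_zero]
    rw [← ih (fun i => μ i.succ) (fun i => g i.succ) fun i => hg i.succ,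
      ← lintegral_prod_mul (hg 0).aemeasurable hm.aemeasurable]
    rfl

theorem pi_withDensity {E : Type*} [MeasurableSpace E] {n : ℕ} (μ : Fin n → Measure E)
    [∀ i, SigmaFinite (μ i)] (g : Fin n → E → ENNReal) (hg : ∀ i, Measurable (g i))
    [∀ i, SigmaFinite ((μ i).withDensity (g i))] :
    Measure.pi (fun i => (μ i).withDensity (g i))
      = (Measure.pi μ).withDensity fun x => ∏ i, g i (x i) := by
  refine Measure.pi_eq fun s hs => ?_
  rw [withDensity_apply _ (MeasurableSet.univ_pi hs), Measure.restrict_pi_pi,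
    lintegral_pi_prod _ g hg]
  exact Finset.prod_congr rfl fun i _ => (withDensity_apply _ (hs i)).symm

/-- The product of the Radon–Nikodym derivatives of the factors is a density of the product measure.
-/
theorem absolutelyContinuous_pi {E : Type*} [MeasurableSpace E] {n : ℕ}
    {μ ν : Fin n → Measure E} [∀ i, SigmaFinite (μ i)] [∀ i, SigmaFinite (ν i)]
    (h : ∀ i, μ i ≪ ν i) : Measure.pi μ ≪ Measure.pi ν := by
  have e : ∀ i, (ν i).withDensity ((μ i).rnDeriv (ν i)) = μ i := fun i =>
    Measure.withDensity_rnDeriv_eq _ _ (h i)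
  have : ∀ i, SigmaFinite ((ν i).withDensity ((μ i).rnDeriv (ν i))) := fun i => by
    rw [e i]; infer_instance
  have := pi_withDensity ν (fun i => (μ i).rnDeriv (ν i))
    fun i => Measure.measurable_rnDeriv _ _
  simp only [e] at this
  rw [this]
  exact withDensity_absolutelyContinuous _ _

/-! ### One-dimensional measures -/

/-- The measure `y^ν dy` on `(0, ∞)`. -/
def powMeasure (ν : ℝ) : Measure ℝ :=
  (volume.restrict (Ioi 0)).withDensity fun y => ENNReal.ofReal (y ^ ν)

/-- The normalizing factor of the one-dimensional generalized translation. -/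
def angleConst (ν : ℝ) : ℝ := Real.Gamma ((ν + 1) / 2) / (√Real.pi * Real.Gamma (ν / 2))

/-- The measure `sin^(ν-1) φ dφ` on `(0, π)`. -/
def sinMeasure (ν : ℝ) : Measure ℝ :=
  (volume.restrict (Ioo 0 Real.pi)).withDensity fun φ => ENNReal.ofReal (Real.sin φ ^ (ν - 1))

/-- The normalized measure `sin^(ν-1) φ dφ` on `(0, π)`. -/
def angleMeasure (ν : ℝ) : Measure ℝ := ENNReal.ofReal (angleConst ν) • sinMeasure ν

theorem angleConst_pos {ν : ℝ} (hν : 0 < ν) : 0 < angleConst ν := by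
  have h1 := Real.Gamma_pos_of_pos (s := (ν + 1) / 2) (by linarith)
  have h2 := Real.Gamma_pos_of_pos (s := ν / 2) (by linarith)
  have := Real.pi_pos
  unfold angleConst
  positivity

instance (ν : ℝ) : SigmaFinite (powMeasure ν) := by unfold powMeasure; infer_instance
instance (ν : ℝ) : SigmaFinite (sinMeasure ν) := by unfold sinMeasure; infer_instance
instance (ν : ℝ) : SigmaFinite (angleMeasure ν) := by
  have : SigmaFinite ((ENNReal.toNNReal (ENNReal.ofReal (angleConst ν))) • sinMeasure ν) :=
    inferInstance
  unfold angleMeasure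
  exact this

theorem lintegral_powMeasure {ν : ℝ} {F : ℝ → ENNReal} (hF : Measurable F) :
    ∫⁻ y, F y ∂(powMeasure ν) = ∫⁻ y in Ioi 0, ENNReal.ofReal (y ^ ν) * F y := by
  unfold powMeasure
  rw [lintegral_withDensity_eq_lintegral_mul _ (by fun_prop) hF]
  rfl

theorem lintegral_powMeasure_gaussian {ν : ℝ} (hν : -1 < ν) :
    ∫⁻ y, ENNReal.ofReal (Real.exp (-y ^ 2)) ∂(powMeasure ν)
      = ENNReal.ofReal (1 / 2 * Real.Gamma ((ν + 1) / 2)) := by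
  have h := integral_rpow_mul_exp_neg_rpow (p := 2) (q := ν) two_pos hν
  have hpos : 0 < 1 / 2 * Real.Gamma ((ν + 1) / 2) := by
    have := Real.Gamma_pos_of_pos (s := (ν + 1) / 2) (by linarith)
    positivity
  rw [lintegral_powMeasure (by fun_prop), ← h, ofReal_integral_eq_lintegral_ofReal]
  · refine setLIntegral_congr_fun measurableSet_Ioi fun y hy => ?_
    have hy : 0 < y := hy
    rw [← ENNReal.ofReal_mul (by positivity)]
    norm_num
  · by_contra hc
    rw [← h, integral_undef hc] at hpos
    exact hpos.false
  · filter_upwards [ae_restrict_mem measurableSet_Ioi] with y hy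
    have hy : 0 < y := hy
    simp only [Pi.zero_apply]
    positivity

/-- Polar coordinates use angles in `(-π, π)`; those with positive sine are exactly the angles in
`(0, π)`, which therefore parametrize the upper half-plane. -/
theorem lintegral_prod_polar {g : ℝ × ℝ → ENNReal} :
    ∫⁻ p in Ioi (0 : ℝ) ×ˢ Ioo (0 : ℝ) Real.pi,
        ENNReal.ofReal p.1 * g (p.1 * Real.cos p.2, p.1 * Real.sin p.2)
      = ∫⁻ q in univ ×ˢ Ioi (0 : ℝ), g q := by
  rw [← lintegral_indicator (MeasurableSet.univ.prod measurableSet_Ioi),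
    ← lintegral_comp_polarCoord_symm, ← lintegral_indicator (measurableSet_Ioi.prod
      measurableSet_Ioo), ← lintegral_indicator polarCoord.open_target.measurableSet]
  congr 1
  ext ⟨r, φ⟩
  simp only [polarCoord_target, polarCoord_symm_apply, indicator, mem_prod, mem_Ioi, mem_Ioo,
    mem_univ, true_and, smul_eq_mul]
  by_cases hr : 0 < r
  swap
  · simp [hr]
  simp only [hr, true_and, mul_pos_iff_of_pos_left hr]
  by_cases h1 : 0 < φ ∧ φ < Real.pi
  · have : 0 < Real.sin φ := Real.sin_pos_of_pos_of_lt_pi h1.1 h1.2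
    have h2 : -Real.pi < φ := by linarith [h1.1, Real.pi_pos]
    simp [h1, h2, this]
  · rw [if_neg h1]
    split_ifs with h2 h3
    · exfalso
      apply h1
      refine ⟨?_, h2.2⟩
      by_contra h4
      exact absurd h3 (not_lt.2 (Real.sin_nonpos_of_nonpos_of_neg_pi_le (not_lt.1 h4) h2.1.le))
    · simp
    · simp

/-- Put `u = y cos φ`, `v = y sin φ`. Then `y^ν sin^(ν-1) φ dy dφ` becomes `v^(ν-1) du dv`, and the
third side is the distance from `(u, v)` to `(x, 0)`. The density does not involve `u`, so a shift
in `u` removes `x`. -/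
theorem lintegral_halfPlane_translate {F : ℝ → ENNReal} (hF : Measurable F) (ν x : ℝ) :
    ∫⁻ p, F √(x ^ 2 + p.1 ^ 2 - 2 * x * p.1 * Real.cos p.2)
        ∂((powMeasure ν).prod (sinMeasure ν))
      = ∫⁻ q in univ ×ˢ Ioi (0 : ℝ),
          F √(q.1 ^ 2 + q.2 ^ 2) * ENNReal.ofReal (q.2 ^ (ν - 1)) := by
  have h1 : ∫⁻ q in univ ×ˢ Ioi (0 : ℝ),
          F √(q.1 ^ 2 + q.2 ^ 2) * ENNReal.ofReal (q.2 ^ (ν - 1))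
      = ∫⁻ q in univ ×ˢ Ioi (0 : ℝ),
          F √((x - q.1) ^ 2 + q.2 ^ 2) * ENNReal.ofReal (q.2 ^ (ν - 1)) := by
    rw [Measure.volume_eq_prod, ← Measure.prod_restrict, Measure.restrict_univ,
      lintegral_prod_symm _ (by fun_prop), lintegral_prod_symm _ (by fun_prop)]
    congr 1
    ext v
    exact (lintegral_sub_left_eq_self (fun u : ℝ => F √(u ^ 2 + v ^ 2) *
      ENNReal.ofReal (v ^ (ν - 1))) x).symm
  rw [h1, ← lintegral_prod_polar]
  unfold powMeasure sinMeasure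
  rw [prod_withDensity (by fun_prop) (by fun_prop), Measure.prod_restrict,
    ← Measure.volume_eq_prod, lintegral_withDensity_eq_lintegral_mul _ (by fun_prop)
      (by fun_prop)]
  refine setLIntegral_congr_fun (measurableSet_Ioi.prod measurableSet_Ioo) ?_
  rintro ⟨y, φ⟩ ⟨hy, hφ⟩
  have hy : 0 < y := hy
  have hs : 0 < Real.sin φ := Real.sin_pos_of_pos_of_lt_pi hφ.1 hφ.2
  simp only [Pi.mul_apply]
  have e1 : (x - y * Real.cos φ) ^ 2 + (y * Real.sin φ) ^ 2
      = x ^ 2 + y ^ 2 - 2 * x * y * Real.cos φ := by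
    have := Real.sin_sq_add_cos_sq φ
    linear_combination y ^ 2 * this
  have e2 : y ^ ν = y * y ^ (ν - 1) := by
    rw [Real.rpow_sub_one hy.ne']; field_simp
  rw [e1, e2, Real.mul_rpow hy.le hs.le, ENNReal.ofReal_mul hy.le,
    ENNReal.ofReal_mul (by positivity)]
  ring

/-- The half-plane integral is independent of `x`; at `x = 0` the third side is `y` and the two
variables separate. -/
theorem lintegral_translate_aux {F : ℝ → ENNReal} (hF : Measurable F) (ν x : ℝ) :
    ∫⁻ p, F √(x ^ 2 + p.1 ^ 2 - 2 * x * p.1 * Real.cos p.2)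
        ∂((powMeasure ν).prod (sinMeasure ν))
      = (∫⁻ y, F y ∂(powMeasure ν)) * sinMeasure ν univ := by
  rw [lintegral_halfPlane_translate hF, ← lintegral_halfPlane_translate hF ν 0,
    lintegral_prod _ (by fun_prop)]
  simp only [zero_pow two_ne_zero, mul_zero, zero_mul, sub_zero, zero_add, lintegral_const]
  rw [lintegral_mul_const _ (by fun_prop)]
  congr 1
  rw [lintegral_powMeasure (by fun_prop), lintegral_powMeasure hF]
  refine setLIntegral_congr_fun measurableSet_Ioi fun y hy => ?_
  have hy : 0 < y := hy
  simp [Real.sqrt_sq hy.le]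

/-- The total mass is found by integrating a Gaussian over the half-plane in Cartesian and in polar
coordinates, which avoids the Beta function. -/
theorem ofReal_angleConst_mul_sinMeasure {ν : ℝ} (hν : 0 < ν) :
    ENNReal.ofReal (angleConst ν) * sinMeasure ν univ = 1 := by
  have h1 := lintegral_translate_aux (F := fun r => ENNReal.ofReal (Real.exp (-r ^ 2)))
    (by fun_prop) ν 0
  rw [lintegral_halfPlane_translate (F := fun r => ENNReal.ofReal (Real.exp (-r ^ 2)))
    (by fun_prop), lintegral_powMeasure_gaussian (by linarith),
    Measure.volume_eq_prod, ← Measure.prod_restrict, Measure.restrict_univ] at h1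
  have h2 : ∀ q : ℝ × ℝ, ENNReal.ofReal (Real.exp (-√(q.1 ^ 2 + q.2 ^ 2) ^ 2)) *
      ENNReal.ofReal (q.2 ^ (ν - 1)) = ENNReal.ofReal (Real.exp (-q.1 ^ 2)) *
      (ENNReal.ofReal (q.2 ^ (ν - 1)) * ENNReal.ofReal (Real.exp (-q.2 ^ 2))) := by
    intro q
    rw [Real.sq_sqrt (by positivity), neg_add, Real.exp_add, ENNReal.ofReal_mul (by positivity)]
    ring
  simp only [h2] at h1
  rw [lintegral_prod_mul (f := fun u : ℝ => ENNReal.ofReal (Real.exp (-u ^ 2)))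
    (g := fun v : ℝ => ENNReal.ofReal (v ^ (ν - 1)) * ENNReal.ofReal (Real.exp (-v ^ 2)))
    (by fun_prop) (by fun_prop), ← lintegral_powMeasure (by fun_prop),
    lintegral_powMeasure_gaussian (by linarith)] at h1
  have h3 : ∫⁻ u : ℝ, ENNReal.ofReal (Real.exp (-u ^ 2)) = ENNReal.ofReal √Real.pi := by
    have := integral_gaussian 1
    have hi := integrable_exp_neg_mul_sq (b := 1) one_pos
    simp only [div_one, neg_mul, one_mul] at this hi
    rw [← this, ofReal_integral_eq_lintegral_ofReal hi (ae_of_all _ fun u => by positivity)]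
  have g1 := Real.Gamma_pos_of_pos (s := (ν + 1) / 2) (by linarith)
  have g2 := Real.Gamma_pos_of_pos (s := ν / 2) (by linarith)
  have hp : 0 < √Real.pi := Real.sqrt_pos.2 Real.pi_pos
  rw [h3, ← ENNReal.ofReal_mul hp.le, sub_add_cancel] at h1
  have g3 : ENNReal.ofReal (angleConst ν)
      = ENNReal.ofReal (√Real.pi * (1 / 2 * Real.Gamma (ν / 2)))⁻¹ *
        ENNReal.ofReal (1 / 2 * Real.Gamma ((ν + 1) / 2)) := by
    rw [← ENNReal.ofReal_mul (by positivity)]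
    congr 1
    unfold angleConst
    field_simp
  rw [g3, mul_assoc, ← h1, ← ENNReal.ofReal_mul (by positivity), inv_mul_cancel₀ (by positivity)]
  simp

theorem isProbabilityMeasure_angleMeasure {ν : ℝ} (hν : 0 < ν) :
    IsProbabilityMeasure (angleMeasure ν) :=
  ⟨by simpa [angleMeasure] using ofReal_angleConst_mul_sinMeasure hν⟩

theorem map_translate_powMeasure {ν : ℝ} (hν : 0 < ν) (x : ℝ) :
    ((powMeasure ν).prod (angleMeasure ν)).map
      (fun p => √(x ^ 2 + p.1 ^ 2 - 2 * x * p.1 * Real.cos p.2)) = powMeasure ν := by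
  refine Measure.ext_of_lintegral _ fun F hF => ?_
  rw [lintegral_map hF (by fun_prop), angleMeasure, Measure.prod_smul_right,
    lintegral_smul_measure, lintegral_translate_aux hF, smul_eq_mul, mul_left_comm,
    ofReal_angleConst_mul_sinMeasure hν, mul_one]

/-! ### Measures on the orthant and on the sphere -/

theorem measurable_translatedPoint {n : ℕ} {α : Type*} [MeasurableSpace α]
    {x y φ : α → Fin n → ℝ} (hx : Measurable x) (hy : Measurable y) (hφ : Measurable φ) :
    Measurable fun a => translatedPoint (x a) (y a) (φ a) := by
  unfold translatedPoint
  fun_prop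

theorem translatedPoint_comm {n : ℕ} (x y φ : Fin n → ℝ) :
    translatedPoint x y φ = translatedPoint y x φ := by
  funext i
  unfold translatedPoint
  congr 1
  ring

theorem measurable_scaled {n : ℕ} {α : Type*} [MeasurableSpace α] {r : α → ℝ}
    {y : α → UnitSphere n} (hr : Measurable r) (hy : Measurable y) :
    Measurable fun a => scaled (r a) (y a) := by
  unfold scaled
  fun_prop

/-- The measure `x^γ dx` on the orthant. -/
def orthantMeasure {n : ℕ} (γ : Fin n → ℝ) : Measure (Fin n → ℝ) :=
  Measure.pi fun i => powMeasure (γ i)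

/-- The product of the measures `angleMeasure (γ i)`. -/
def cubeMeasure {n : ℕ} (γ : Fin n → ℝ) : Measure (Fin n → ℝ) :=
  Measure.pi fun i => angleMeasure (γ i)

instance {n : ℕ} (γ : Fin n → ℝ) : SigmaFinite (orthantMeasure γ) := by
  unfold orthantMeasure; infer_instance

instance {n : ℕ} (γ : Fin n → ℝ) : SigmaFinite (cubeMeasure γ) := by
  unfold cubeMeasure; infer_instance

theorem isProbabilityMeasure_cubeMeasure {n : ℕ} {γ : Fin n → ℝ} (hγ : ∀ i, 0 < γ i) :
    IsProbabilityMeasure (cubeMeasure γ) := by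
  have : ∀ i, IsProbabilityMeasure (angleMeasure (γ i)) := fun i =>
    isProbabilityMeasure_angleMeasure (hγ i)
  unfold cubeMeasure
  infer_instance

theorem map_translatedPoint_orthantMeasure {n : ℕ} {γ : Fin n → ℝ} (hγ : ∀ i, 0 < γ i)
    (x : Fin n → ℝ) :
    ((orthantMeasure γ).prod (cubeMeasure γ)).map (fun p => translatedPoint x p.1 p.2)
      = orthantMeasure γ := by
  -- Regrouping `(y, φ)` as the family of pairs `(yᵢ, φᵢ)` makes the map act coordinatewise.
  have h := measurePreserving_arrowProdEquivProdArrow ℝ ℝ (Fin n) (fun i => powMeasure (γ i))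
    fun i => angleMeasure (γ i)
  unfold orthantMeasure cubeMeasure
  rw [← h.map_eq, Measure.map_map
    (measurable_translatedPoint measurable_const measurable_fst measurable_snd) h.measurable]
  have e : ∀ i, ((powMeasure (γ i)).prod (angleMeasure (γ i))).map
      (fun p => √(x i ^ 2 + p.1 ^ 2 - 2 * x i * p.1 * Real.cos p.2)) = powMeasure (γ i) :=
    fun i => map_translate_powMeasure (hγ i) (x i)
  have : ∀ i, SigmaFinite (((powMeasure (γ i)).prod (angleMeasure (γ i))).map
      (fun p => √(x i ^ 2 + p.1 ^ 2 - 2 * x i * p.1 * Real.cos p.2))) := fun i => by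
    rw [e i]; infer_instance
  have h2 := Measure.pi_map_pi (μ := fun i => (powMeasure (γ i)).prod (angleMeasure (γ i)))
    (f := fun i p => √(x i ^ 2 + p.1 ^ 2 - 2 * x i * p.1 * Real.cos p.2))
    fun i => Measurable.aemeasurable (by fun_prop)
  simp only [e] at h2
  exact h2

theorem lintegral_translatedPoint {n : ℕ} {γ : Fin n → ℝ} (hγ : ∀ i, 0 < γ i)
    (x : Fin n → ℝ) {F : (Fin n → ℝ) → ENNReal} (hF : Measurable F) :
    ∫⁻ y, ∫⁻ φ, F (translatedPoint x y φ) ∂(cubeMeasure γ) ∂(orthantMeasure γ)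
      = ∫⁻ z, F z ∂(orthantMeasure γ) := by
  have hm : Measurable fun p : (Fin n → ℝ) × (Fin n → ℝ) => translatedPoint x p.1 p.2 :=
    measurable_translatedPoint measurable_const measurable_fst measurable_snd
  conv_rhs => rw [← map_translatedPoint_orthantMeasure hγ x]
  rw [lintegral_map hF hm]
  exact (lintegral_prod _ (hF.comp hm).aemeasurable).symm

theorem orthantMeasure_eq_withDensity {n : ℕ} (γ : Fin n → ℝ) :
    orthantMeasure γ = (volume.restrict (posOrthant n)).withDensity
      fun x => ENNReal.ofReal (powWeight γ x) := by
  unfold orthantMeasure powMeasure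
  rw [pi_withDensity _ _ (fun i => by fun_prop), ← Measure.restrict_pi_pi, ← volume_pi]
  have : (univ.pi fun _ : Fin n => Ioi (0 : ℝ)) = posOrthant n := by
    ext x; simp [posOrthant]
  rw [this]
  refine withDensity_congr_ae ?_
  have hm : MeasurableSet (posOrthant n) := by
    rw [← this]; exact MeasurableSet.univ_pi fun _ => measurableSet_Ioi
  filter_upwards [ae_restrict_mem hm] with x hx
  unfold powWeight
  rw [ENNReal.ofReal_prod_of_nonneg fun i _ => Real.rpow_nonneg (hx i).le _]

theorem measurableSet_posOrthant (n : ℕ) : MeasurableSet (posOrthant n) := by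
  have : (univ.pi fun _ : Fin n => Ioi (0 : ℝ)) = posOrthant n := by
    ext x; simp [posOrthant]
  rw [← this]; exact MeasurableSet.univ_pi fun _ => measurableSet_Ioi

theorem measurableSet_posSphere (n : ℕ) : MeasurableSet (posSphere n) := by
  have : posSphere n = ⋂ i, {y : UnitSphere n | 0 < y.1 i} := by ext; simp [posSphere]
  rw [this]
  exact MeasurableSet.iInter fun i => measurableSet_lt measurable_const (by fun_prop)

theorem measurable_powWeight {n : ℕ} (γ : Fin n → ℝ) : Measurable (powWeight γ) := by
  unfold powWeight; fun_prop

theorem measurable_sphereWeight {n : ℕ} (γ : Fin n → ℝ) :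
    Measurable (sphereWeight γ : UnitSphere n → ℝ) := by
  unfold sphereWeight; fun_prop

/-- The measure `y^γ dS(y)` on `S₁⁺(n)`. -/
def weightedSphere {n : ℕ} (γ : Fin n → ℝ) : Measure (UnitSphere n) :=
  ((surfaceMeasure n).restrict (posSphere n)).withDensity
    fun y => ENNReal.ofReal (sphereWeight γ y)

instance (n : ℕ) : IsFiniteMeasure (surfaceMeasure n) := by
  unfold surfaceMeasure; infer_instance

instance {n : ℕ} (γ : Fin n → ℝ) : SigmaFinite (weightedSphere γ) := by
  unfold weightedSphere; infer_instance

theorem lintegral_polar {n : ℕ} (hn : 0 < n) {H : EuclideanSpace ℝ (Fin n) → ENNReal}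
    (hH : Measurable H) :
    ∫⁻ z, H z = ∫⁻ y : UnitSphere n, (∫⁻ r in Ioi (0 : ℝ),
      ENNReal.ofReal (r ^ (n - 1)) * H (r • y.1)) ∂(surfaceMeasure n) := by
  have : Nontrivial (EuclideanSpace ℝ (Fin n)) := by
    have : Nonempty (Fin n) := ⟨⟨0, hn⟩⟩
    infer_instance
  have hp := (volume : Measure (EuclideanSpace ℝ (Fin n))).measurePreserving_homeomorphUnitSphereProd
  have h1 := hp.symm (homeomorphUnitSphereProd (EuclideanSpace ℝ (Fin n))).toMeasurableEquiv
  -- The polar homeomorphism is defined off the origin, which is a null set.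
  rw [← restrict_compl_singleton (μ := volume) (0 : EuclideanSpace ℝ (Fin n)),
    ← lintegral_subtype_comap (measurableSet_singleton _).compl]
  have h2 := h1.lintegral_comp (f := fun z => H z.1) (by fun_prop)
  rw [← h2, lintegral_prod _ (Measurable.aemeasurable (by fun_prop))]
  unfold surfaceMeasure
  congr 1
  ext y
  simp only [finrank_euclideanSpace, Fintype.card_fin]
  unfold Measure.volumeIoiPow
  rw [lintegral_withDensity_eq_lintegral_mul _ (by fun_prop) (by fun_prop),
    ← lintegral_subtype_comap measurableSet_Ioi]
  rfl

/-- The weight is homogeneous of degree `|γ|`, which together with the Jacobian `r^(n-1)` gives the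
radial exponent `n + |γ| - 1`. -/
theorem lintegral_orthantMeasure {n : ℕ} (hn : 0 < n) (γ : Fin n → ℝ)
    {F : (Fin n → ℝ) → ENNReal} (hF : Measurable F) :
    ∫⁻ z, F z ∂(orthantMeasure γ)
      = ∫⁻ r, ∫⁻ y, F (scaled r y) ∂(weightedSphere γ) ∂(powMeasure (effDim γ - 1)) := by
  have hm : Measurable fun p : UnitSphere n × ℝ => F (scaled p.2 p.1) :=
    hF.comp (measurable_scaled measurable_snd measurable_fst)
  have hm2 : ∀ y : UnitSphere n, Measurable fun r => F (scaled r y) := fun y =>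
    hF.comp (measurable_scaled measurable_id measurable_const)
  have hw := measurable_powWeight γ
  have hw2 := measurable_sphereWeight γ
  rw [lintegral_lintegral_swap (f := fun r y => F (scaled r y)) (hF.comp (measurable_scaled measurable_fst
    measurable_snd)).aemeasurable, orthantMeasure_eq_withDensity, weightedSphere,
    lintegral_withDensity_eq_lintegral_mul _ (by fun_prop) (hm.lintegral_prod_right'),
    lintegral_withDensity_eq_lintegral_mul _ (by fun_prop) hF,
    ← lintegral_indicator (measurableSet_posOrthant n),
    ← lintegral_indicator (measurableSet_posSphere n),
    ← (PiLp.volume_preserving_ofLp (Fin n)).lintegral_comp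
      (Measurable.indicator (by fun_prop) (measurableSet_posOrthant n))]
  refine (lintegral_polar hn (Measurable.comp (Measurable.indicator (by fun_prop)
      (measurableSet_posOrthant n)) (by fun_prop : Measurable
        fun z : EuclideanSpace ℝ (Fin n) => WithLp.ofLp z))).trans ?_
  refine lintegral_congr fun y => ?_
  have key : ∀ r ∈ Ioi (0 : ℝ), ENNReal.ofReal (r ^ (n - 1)) *
      (posOrthant n).indicator ((fun x => ENNReal.ofReal (powWeight γ x)) * F)
        (WithLp.ofLp (r • y.1))
      = (posSphere n).indicator (fun y => ENNReal.ofReal (sphereWeight γ y)) y *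
        (ENNReal.ofReal (r ^ (effDim γ - 1)) * F (scaled r y)) := by
    intro r hr
    have hr : 0 < r := hr
    have e0 : WithLp.ofLp (r • y.1) = scaled r y := by
      funext i; simp [scaled]
    rw [e0]
    by_cases hy : y ∈ posSphere n
    · have h1 : scaled r y ∈ posOrthant n := fun i => mul_pos hr (hy i)
      rw [indicator_of_mem h1, indicator_of_mem hy]
      have e1 : powWeight γ (scaled r y) = r ^ (∑ i, γ i) * sphereWeight γ y := by
        unfold powWeight scaled sphereWeight
        rw [Real.rpow_sum_of_pos hr, ← Finset.prod_mul_distrib]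
        exact Finset.prod_congr rfl fun i _ => Real.mul_rpow hr.le (hy i).le
      have e2 : r ^ (effDim γ - 1) = r ^ (n - 1) * r ^ (∑ i, γ i) := by
        rw [← Real.rpow_natCast, ← Real.rpow_add hr, Nat.cast_pred hn]
        congr 1
        unfold effDim
        ring
      simp only [Pi.mul_apply]
      rw [e1, e2, ENNReal.ofReal_mul (by positivity), ENNReal.ofReal_mul (by positivity)]
      ring
    · have h1 : scaled r y ∉ posOrthant n := by
        intro h
        exact hy fun i => (mul_pos_iff_of_pos_left hr).1 (h i)
      rw [indicator_of_notMem h1, indicator_of_notMem hy]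
      simp
  have hm3 : Measurable fun r => ENNReal.ofReal (r ^ (effDim γ - 1)) * F (scaled r y) :=
    Measurable.mul (by fun_prop) (hm2 y)
  simp only [Function.comp_apply]
  rw [setLIntegral_congr_fun measurableSet_Ioi key, lintegral_const_mul _ hm3,
    ← lintegral_powMeasure (hm2 y)]
  by_cases hy : y ∈ posSphere n
  · rw [indicator_of_mem hy, indicator_of_mem hy]; rfl
  · rw [indicator_of_notMem hy, indicator_of_notMem hy, zero_mul]

/-! ### The weighted area of the sphere and the measure of a spherical mean -/

theorem sum_sq_scaled {n : ℕ} (r : ℝ) (y : UnitSphere n) : ∑ i, scaled r y i ^ 2 = r ^ 2 := by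
  have h := EuclideanSpace.real_norm_sq_eq y.1
  rw [norm_eq_of_mem_sphere y] at h
  simp only [scaled, mul_pow, ← Finset.mul_sum, ← h]
  ring

theorem effDim_pos {n : ℕ} (hn : 0 < n) {γ : Fin n → ℝ} (hγ : ∀ i, -1 < γ i) :
    0 < effDim γ := by
  have : Nonempty (Fin n) := ⟨⟨0, hn⟩⟩
  have h : ∑ i : Fin n, (0 : ℝ) < ∑ i, (1 + γ i) :=
    Finset.sum_lt_sum_of_nonempty Finset.univ_nonempty fun i _ => by linarith [hγ i]
  simpa [effDim, Finset.sum_add_distrib] using h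

theorem one_lt_effDim {n : ℕ} (hn : 0 < n) {γ : Fin n → ℝ} (hγ : ∀ i, 0 < γ i) :
    1 < effDim γ := by
  have : Nonempty (Fin n) := ⟨⟨0, hn⟩⟩
  have h : 0 < ∑ i, γ i := Finset.sum_pos (fun i _ => hγ i) Finset.univ_nonempty
  have h1 : (1 : ℝ) ≤ n := by exact_mod_cast hn
  unfold effDim
  linarith

/-- A Gaussian factors over the coordinates and is radial; integrating it both ways isolates the
area. The range `γ i > -1` is natural here, since only the Gamma integrals have to converge. -/
theorem weightedSphere_univ_mul {n : ℕ} (hn : 0 < n) {γ : Fin n → ℝ} (hγ : ∀ i, -1 < γ i) :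
    weightedSphere γ univ * ENNReal.ofReal (1 / 2 * Real.Gamma (effDim γ / 2))
      = ENNReal.ofReal (∏ i, (1 / 2 * Real.Gamma ((γ i + 1) / 2))) := by
  have h1 := lintegral_orthantMeasure hn γ
    (F := fun z => ENNReal.ofReal (Real.exp (-∑ i, z i ^ 2))) (by fun_prop)
  simp only [sum_sq_scaled, lintegral_const] at h1
  have hd := effDim_pos hn hγ
  rw [lintegral_mul_const _ (by fun_prop), lintegral_powMeasure_gaussian (by linarith),
    sub_add_cancel] at h1
  rw [mul_comm, ← h1]
  have h2 : ∀ z : Fin n → ℝ, ENNReal.ofReal (Real.exp (-∑ i, z i ^ 2))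
      = ∏ i, ENNReal.ofReal (Real.exp (-z i ^ 2)) := by
    intro z
    rw [← Finset.sum_neg_distrib, Real.exp_sum, ENNReal.ofReal_prod_of_nonneg
      fun i _ => (Real.exp_pos _).le]
  simp only [h2]
  unfold orthantMeasure
  rw [lintegral_pi_prod _ (fun _ t => ENNReal.ofReal (Real.exp (-t ^ 2))) (fun i => by fun_prop),
    ENNReal.ofReal_prod_of_nonneg]
  · exact Finset.prod_congr rfl fun i _ => lintegral_powMeasure_gaussian (hγ i)
  · intro i _
    have := Real.Gamma_pos_of_pos (s := (γ i + 1) / 2) (by linarith [hγ i])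
    positivity

theorem sphereArea_eq_toReal {n : ℕ} (γ : Fin n → ℝ) :
    sphereArea γ = (weightedSphere γ univ).toReal := by
  unfold sphereArea weightedSphere
  rw [withDensity_apply _ MeasurableSet.univ, Measure.restrict_univ,
    integral_eq_lintegral_of_nonneg_ae _ (measurable_sphereWeight γ).aestronglyMeasurable]
  filter_upwards [ae_restrict_mem (measurableSet_posSphere n)] with y hy
  exact Finset.prod_nonneg fun i _ => Real.rpow_nonneg (hy i).le _

theorem sphereArea_eq {n : ℕ} (hn : 0 < n) {γ : Fin n → ℝ} (hγ : ∀ i, -1 < γ i) :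
    sphereArea γ
      = (∏ i, (1 / 2 * Real.Gamma ((γ i + 1) / 2))) / (1 / 2 * Real.Gamma (effDim γ / 2)) := by
  have h := congrArg ENNReal.toReal (weightedSphere_univ_mul hn hγ)
  have hd := Real.Gamma_pos_of_pos (s := effDim γ / 2) (by linarith [effDim_pos hn hγ])
  have hp : 0 < ∏ i, (1 / 2 * Real.Gamma ((γ i + 1) / 2)) := Finset.prod_pos fun i _ => by
    have := Real.Gamma_pos_of_pos (s := (γ i + 1) / 2) (by linarith [hγ i])
    positivity
  rw [ENNReal.toReal_mul, ENNReal.toReal_ofReal (by positivity), ENNReal.toReal_ofReal hp.le,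
    ← sphereArea_eq_toReal] at h
  rw [← h]
  field_simp

theorem sphereArea_pos {n : ℕ} (hn : 0 < n) {γ : Fin n → ℝ} (hγ : ∀ i, -1 < γ i) :
    0 < sphereArea γ := by
  have hd := Real.Gamma_pos_of_pos (s := effDim γ / 2) (by linarith [effDim_pos hn hγ])
  rw [sphereArea_eq hn hγ]
  refine div_pos (Finset.prod_pos fun i _ => ?_) (by positivity)
  have := Real.Gamma_pos_of_pos (s := (γ i + 1) / 2) (by linarith [hγ i])
  positivity

theorem weightedSphere_univ {n : ℕ} (hn : 0 < n) {γ : Fin n → ℝ} (hγ : ∀ i, -1 < γ i) :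
    weightedSphere γ univ = ENNReal.ofReal (sphereArea γ) := by
  have h := sphereArea_pos hn hγ
  rw [sphereArea_eq_toReal] at h ⊢
  rw [ENNReal.ofReal_toReal]
  exact (ENNReal.toReal_pos_iff.1 h).2.ne

/-- The measure `y^γ dS(y)` on `S₁⁺(n)`, normalized. -/
def uniformSphere {n : ℕ} (γ : Fin n → ℝ) : Measure (UnitSphere n) :=
  ENNReal.ofReal (1 / sphereArea γ) • weightedSphere γ

/-- The normalized measure defining the weighted spherical mean. -/
def meanMeasure {n : ℕ} (γ : Fin n → ℝ) : Measure (UnitSphere n × (Fin n → ℝ)) :=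
  (uniformSphere γ).prod (cubeMeasure γ)

theorem isProbabilityMeasure_uniformSphere {n : ℕ} (hn : 0 < n) {γ : Fin n → ℝ}
    (hγ : ∀ i, -1 < γ i) : IsProbabilityMeasure (uniformSphere γ) := by
  have h := sphereArea_pos hn hγ
  constructor
  unfold uniformSphere
  rw [Measure.smul_apply, weightedSphere_univ hn hγ, smul_eq_mul,
    ← ENNReal.ofReal_mul (by positivity), one_div_mul_cancel h.ne', ENNReal.ofReal_one]

theorem isProbabilityMeasure_meanMeasure {n : ℕ} (hn : 0 < n) {γ : Fin n → ℝ}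
    (hγ : ∀ i, 0 < γ i) : IsProbabilityMeasure (meanMeasure γ) := by
  have := isProbabilityMeasure_uniformSphere hn (γ := γ) fun i => by linarith [hγ i]
  have := isProbabilityMeasure_cubeMeasure hγ
  unfold meanMeasure
  infer_instance

instance {n : ℕ} (γ : Fin n → ℝ) : SigmaFinite (uniformSphere γ) := by
  have : SigmaFinite ((ENNReal.toNNReal (ENNReal.ofReal (1 / sphereArea γ)))
    • weightedSphere γ) := inferInstance
  unfold uniformSphere
  exact this

instance {n : ℕ} (γ : Fin n → ℝ) : SigmaFinite (meanMeasure γ) := by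
  unfold meanMeasure; infer_instance

theorem measurableSet_cube (n : ℕ) :
    MeasurableSet (univ.pi fun _ : Fin n => Ioo (0 : ℝ) Real.pi) :=
  MeasurableSet.univ_pi fun _ => measurableSet_Ioo

theorem measurableSet_meanDomain (n : ℕ) : MeasurableSet (meanDomain n) :=
  (measurableSet_posSphere n).prod (measurableSet_cube n)

theorem measurable_meanWeight {n : ℕ} (γ : Fin n → ℝ) :
    Measurable (meanWeight γ : UnitSphere n × (Fin n → ℝ) → ℝ) := by
  have := measurable_sphereWeight γ
  unfold meanWeight; fun_prop

theorem meanWeight_pos {n : ℕ} (γ : Fin n → ℝ) {p : UnitSphere n × (Fin n → ℝ)}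
    (hp : p ∈ meanDomain n) : 0 < meanWeight γ p := by
  refine mul_pos (Finset.prod_pos fun i _ => Real.rpow_pos_of_pos (hp.1 i) _)
    (Finset.prod_pos fun i _ => Real.rpow_pos_of_pos ?_ _)
  have := hp.2 i (mem_univ i)
  exact Real.sin_pos_of_pos_of_lt_pi this.1 this.2

/-- The factor relating `meanMeasure` to the unnormalized weight. -/
def cubeConst {n : ℕ} (γ : Fin n → ℝ) : ℝ := ∏ i, angleConst (γ i)

theorem cubeConst_pos {n : ℕ} {γ : Fin n → ℝ} (hγ : ∀ i, 0 < γ i) : 0 < cubeConst γ :=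
  Finset.prod_pos fun i _ => angleConst_pos (hγ i)

theorem cubeMeasure_eq {n : ℕ} {γ : Fin n → ℝ} (hγ : ∀ i, 0 < γ i) :
    cubeMeasure γ = ENNReal.ofReal (cubeConst γ) •
      (volume.restrict (univ.pi fun _ : Fin n => Ioo (0 : ℝ) Real.pi)).withDensity
        fun φ => ENNReal.ofReal (∏ i, Real.sin (φ i) ^ (γ i - 1)) := by
  have h1 : cubeMeasure γ = ENNReal.ofReal (cubeConst γ) •
      Measure.pi fun i => sinMeasure (γ i) := by
    unfold cubeMeasure angleMeasure
    have : ∀ i, SigmaFinite (ENNReal.ofReal (angleConst (γ i)) • sinMeasure (γ i)) := fun i =>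
      inferInstanceAs (SigmaFinite (angleMeasure (γ i)))
    refine Measure.pi_eq fun s hs => ?_
    rw [Measure.smul_apply, Measure.pi_pi, smul_eq_mul, cubeConst,
      ENNReal.ofReal_prod_of_nonneg fun i _ => (angleConst_pos (hγ i)).le,
      ← Finset.prod_mul_distrib]
    rfl
  rw [h1]
  unfold sinMeasure
  rw [pi_withDensity _ _ (fun i => by fun_prop), ← Measure.restrict_pi_pi, ← volume_pi]
  congr 1
  refine withDensity_congr_ae ?_
  filter_upwards [ae_restrict_mem (measurableSet_cube n)] with φ hφ
  rw [ENNReal.ofReal_prod_of_nonneg]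
  intro i _
  have := hφ i (mem_univ i)
  exact Real.rpow_nonneg (Real.sin_pos_of_pos_of_lt_pi this.1 this.2).le _

theorem meanMeasure_eq {n : ℕ} {γ : Fin n → ℝ} (hγ : ∀ i, 0 < γ i) :
    meanMeasure γ = ENNReal.ofReal (1 / sphereArea γ) • ENNReal.ofReal (cubeConst γ) •
      (((surfaceMeasure n).prod volume).restrict (meanDomain n)).withDensity
        fun p => ENNReal.ofReal (meanWeight γ p) := by
  have := measurable_sphereWeight γ
  unfold meanMeasure uniformSphere weightedSphere
  rw [cubeMeasure_eq hγ, Measure.prod_smul_left, Measure.prod_smul_right,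
    prod_withDensity (by fun_prop) (by fun_prop), Measure.prod_restrict]
  congr 2
  refine withDensity_congr_ae ?_
  filter_upwards [ae_restrict_mem (measurableSet_meanDomain n)] with p hp
  rw [meanWeight, ENNReal.ofReal_mul]
  exact Finset.prod_nonneg fun i _ => Real.rpow_nonneg (hp.1 i).le _

theorem integrable_withDensity_ofReal_iff {α : Type*} [MeasurableSpace α] {μ : Measure α}
    {s : Set α} (hs : MeasurableSet s) {w : α → ℝ} (hw : Measurable w)
    (hp : ∀ a ∈ s, 0 < w a) (f : α → ℝ) :
    Integrable f ((μ.restrict s).withDensity fun a => ENNReal.ofReal (w a)) ↔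
      IntegrableOn (fun a => f a * w a) s μ := by
  rw [integrable_withDensity_iff_integrable_smul' (by fun_prop) (by simp)]
  refine integrable_congr ?_
  filter_upwards [ae_restrict_mem hs] with a ha
  rw [ENNReal.toReal_ofReal (hp a ha).le, smul_eq_mul, mul_comm]

theorem meanConverges_iff {n : ℕ} (hn : 0 < n) {γ : Fin n → ℝ} (hγ : ∀ i, 0 < γ i) (r : ℝ)
    (f : (Fin n → ℝ) → ℝ) (x : Fin n → ℝ) :
    MeanConverges γ r f x ↔
      Integrable (fun p : UnitSphere n × (Fin n → ℝ) =>
        f (translatedPoint x (scaled r p.1) p.2)) (meanMeasure γ) := by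
  have h1 := sphereArea_pos hn (γ := γ) fun i => by linarith [hγ i]
  have h2 := cubeConst_pos hγ
  rw [meanMeasure_eq hγ, integrable_smul_measure (by simpa using h1) (by simp),
    integrable_smul_measure (by simpa using h2) (by simp),
    integrable_withDensity_ofReal_iff (measurableSet_meanDomain n) (measurable_meanWeight γ)
      fun p hp => meanWeight_pos γ hp]
  rfl

theorem iteratedMeanConverges_iff {n : ℕ} (hn : 0 < n) {γ : Fin n → ℝ} (hγ : ∀ i, 0 < γ i)
    (l m : ℝ) (f : (Fin n → ℝ) → ℝ) (x : Fin n → ℝ) :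
    IteratedMeanConverges γ l m f x ↔
      Integrable (fun p : (UnitSphere n × (Fin n → ℝ)) × (UnitSphere n × (Fin n → ℝ)) =>
        f (translatedPoint (translatedPoint x (scaled l p.1.1) p.1.2) (scaled m p.2.1) p.2.2))
        ((meanMeasure γ).prod (meanMeasure γ)) := by
  have h1 := sphereArea_pos hn (γ := γ) fun i => by linarith [hγ i]
  have h2 := cubeConst_pos hγ
  have hm := measurable_meanWeight γ
  have e : (meanMeasure γ).prod (meanMeasure γ)
      = ENNReal.ofReal (1 / sphereArea γ) • ENNReal.ofReal (cubeConst γ) •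
        ENNReal.ofReal (1 / sphereArea γ) • ENNReal.ofReal (cubeConst γ) •
        (((((surfaceMeasure n).prod volume).prod ((surfaceMeasure n).prod volume)).restrict
          (meanDomain n ×ˢ meanDomain n)).withDensity
        fun p => ENNReal.ofReal (meanWeight γ p.1 * meanWeight γ p.2)) := by
    rw [meanMeasure_eq hγ, Measure.prod_smul_left, Measure.prod_smul_left,
      Measure.prod_smul_right, Measure.prod_smul_right,
      prod_withDensity (by fun_prop) (by fun_prop), Measure.prod_restrict]
    congr 4
    refine withDensity_congr_ae ?_
    filter_upwards [ae_restrict_mem ((measurableSet_meanDomain n).prod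
      (measurableSet_meanDomain n))] with p hp
    rw [ENNReal.ofReal_mul (meanWeight_pos γ hp.1).le]
  rw [e, integrable_smul_measure (by simpa using h1) (by simp),
    integrable_smul_measure (by simpa using h2) (by simp),
    integrable_smul_measure (by simpa using h1) (by simp),
    integrable_smul_measure (by simpa using h2) (by simp),
    integrable_withDensity_ofReal_iff ((measurableSet_meanDomain n).prod
      (measurableSet_meanDomain n)) (by fun_prop)
      fun p hp => mul_pos (meanWeight_pos γ hp.1) (meanWeight_pos γ hp.2)]
  rfl

/-! ### The law of cosines as a change of variables -/

/-- The third side of a triangle with sides `s`, `t` and enclosed angle `φ`. -/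
def triangleSide (s t φ : ℝ) : ℝ := √(s ^ 2 + t ^ 2 - 2 * s * t * Real.cos φ)

theorem continuous_triangleSide (s t : ℝ) : Continuous (triangleSide s t) := by
  unfold triangleSide; fun_prop

theorem triangleSide_comm (s t φ : ℝ) : triangleSide s t φ = triangleSide t s φ := by
  unfold triangleSide; congr 1; ring

theorem triangleSide_radicand_nonneg (s t φ : ℝ) :
    0 ≤ s ^ 2 + t ^ 2 - 2 * s * t * Real.cos φ := by
  have := Real.sin_sq_add_cos_sq φ
  nlinarith [sq_nonneg (s - t * Real.cos φ), sq_nonneg (t * Real.sin φ)]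

theorem triangleSide_sq (s t φ : ℝ) :
    triangleSide s t φ ^ 2 = s ^ 2 + t ^ 2 - 2 * s * t * Real.cos φ :=
  Real.sq_sqrt (triangleSide_radicand_nonneg s t φ)

theorem triangleSide_le (s t φ : ℝ) : triangleSide s t φ ≤ |s| + |t| := by
  refine Real.sqrt_le_iff.2 ⟨by positivity, ?_⟩
  have h1 : -(s * t * Real.cos φ) ≤ |s| * |t| := by
    refine (neg_le_abs _).trans ?_
    rw [abs_mul, abs_mul]
    exact mul_le_of_le_one_right (by positivity) (Real.abs_cos_le_one φ)
  nlinarith [sq_abs s, sq_abs t]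

theorem triangleSide_nonneg (s t φ : ℝ) : 0 ≤ triangleSide s t φ := Real.sqrt_nonneg _

theorem cos_lt_one_of_mem {φ : ℝ} (h : φ ∈ Ioo 0 Real.pi) : Real.cos φ < 1 := by
  rw [← Real.cos_zero]
  exact Real.cos_lt_cos_of_nonneg_of_le_pi le_rfl h.2.le h.1

theorem neg_one_lt_cos_of_mem {φ : ℝ} (h : φ ∈ Ioo 0 Real.pi) : -1 < Real.cos φ := by
  rw [← Real.cos_pi]
  exact Real.cos_lt_cos_of_nonneg_of_le_pi h.1.le le_rfl h.2

theorem triangleSide_radicand_pos {s t φ : ℝ} (hs : 0 < s) (ht : 0 < t)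
    (h : φ ∈ Ioo 0 Real.pi) : 0 < s ^ 2 + t ^ 2 - 2 * s * t * Real.cos φ := by
  have := cos_lt_one_of_mem h
  nlinarith [sq_nonneg (s - t), mul_pos hs ht]

theorem triangleSide_pos {s t φ : ℝ} (hs : 0 < s) (ht : 0 < t)
    (h : φ ∈ Ioo 0 Real.pi) : 0 < triangleSide s t φ :=
  Real.sqrt_pos.2 (triangleSide_radicand_pos hs ht h)

theorem hasDerivAt_triangleSide {s t φ : ℝ} (hs : 0 < s) (ht : 0 < t)
    (h : φ ∈ Ioo 0 Real.pi) :
    HasDerivAt (triangleSide s t) (s * t * Real.sin φ / triangleSide s t φ) φ := by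
  have h1 : HasDerivAt (fun φ => s ^ 2 + t ^ 2 - 2 * s * t * Real.cos φ)
      (-(2 * s * t * -Real.sin φ)) φ :=
    ((Real.hasDerivAt_cos φ).const_mul _).const_sub _
  have h2 : HasDerivAt (triangleSide s t)
      (-(2 * s * t * -Real.sin φ) / (2 * triangleSide s t φ)) φ :=
    h1.sqrt (triangleSide_radicand_pos hs ht h).ne'
  have := triangleSide_pos hs ht h
  exact h2.congr_deriv (by field_simp)

theorem injOn_triangleSide {s t : ℝ} (hs : 0 < s) (ht : 0 < t) :
    InjOn (triangleSide s t) (Ioo 0 Real.pi) := by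
  intro a ha b hb h
  have h2 := congrArg (· ^ 2) h
  simp only [triangleSide_sq] at h2
  refine Real.injOn_cos ⟨ha.1.le, ha.2.le⟩ ⟨hb.1.le, hb.2.le⟩ ?_
  have : 0 < s * t := mul_pos hs ht
  nlinarith

theorem image_triangleSide {s t : ℝ} (hs : 0 < s) (ht : 0 < t) :
    triangleSide s t '' Ioo 0 Real.pi = Ioo |s - t| (s + t) := by
  have hst : 0 < s * t := mul_pos hs ht
  ext r
  constructor
  · rintro ⟨φ, hφ, rfl⟩
    have h1 := triangleSide_sq s t φ
    have h2 := cos_lt_one_of_mem hφ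
    have h3 := neg_one_lt_cos_of_mem hφ
    have h4 := triangleSide_nonneg s t φ
    refine ⟨abs_lt_of_sq_lt_sq ?_ h4, lt_of_pow_lt_pow_left₀ 2 (by positivity) ?_⟩ <;>
      nlinarith
  · rintro ⟨h1, h2⟩
    have h0 : 0 < r := (abs_nonneg _).trans_lt h1
    have h3 : (s - t) ^ 2 < r ^ 2 := by
      rw [← sq_abs (s - t)]; exact pow_lt_pow_left₀ h1 (abs_nonneg _) two_ne_zero
    have h4 : r ^ 2 < (s + t) ^ 2 := pow_lt_pow_left₀ h2 h0.le two_ne_zero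
    have e1 : -1 < (s ^ 2 + t ^ 2 - r ^ 2) / (2 * s * t) := by
      rw [lt_div_iff₀ (by positivity)]; linarith
    have e2 : (s ^ 2 + t ^ 2 - r ^ 2) / (2 * s * t) < 1 := by
      rw [div_lt_one (by positivity)]; linarith
    refine ⟨Real.arccos ((s ^ 2 + t ^ 2 - r ^ 2) / (2 * s * t)),
      ⟨Real.arccos_pos.2 e2, ?_⟩, ?_⟩
    · refine lt_of_le_of_ne (Real.arccos_le_pi _) fun h => ?_
      exact absurd (Real.arccos_eq_pi.1 h) (not_le.2 e1)
    · unfold triangleSide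
      rw [Real.cos_arccos e1.le e2.le, mul_div_cancel₀ _ (by positivity)]
      rw [show s ^ 2 + t ^ 2 - (s ^ 2 + t ^ 2 - r ^ 2) = r ^ 2 by ring, Real.sqrt_sq h0.le]

theorem ae_angleMeasure_mem (ν : ℝ) : ∀ᵐ φ ∂(angleMeasure ν), φ ∈ Ioo 0 Real.pi := by
  unfold angleMeasure sinMeasure
  refine Measure.ae_smul_measure ?_ _
  exact (withDensity_absolutelyContinuous _ _).ae_le (ae_restrict_mem measurableSet_Ioo)

/-- The side is injective in the angle with nonvanishing derivative on `(0, π)`. By change of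
variables the integral of the derivative over the preimage of a null set is zero, so the preimage is
null. -/
theorem map_triangleSide_absolutelyContinuous {s t : ℝ} (hs : 0 < s) (ht : 0 < t) (ν : ℝ) :
    (angleMeasure ν).map (triangleSide s t) ≪ volume.restrict (Ioi 0) := by
  have hm : Measurable (triangleSide s t) := (continuous_triangleSide s t).measurable
  refine Measure.AbsolutelyContinuous.mk fun N hN h0 => ?_
  rw [Measure.map_apply hm hN]
  have hac : angleMeasure ν ≪ volume.restrict (Ioo 0 Real.pi) := by
    unfold angleMeasure sinMeasure
    exact (withDensity_absolutelyContinuous _ _).smul_left _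
  refine hac ?_
  rw [Measure.restrict_apply (hm hN)]
  rw [Measure.restrict_apply hN] at h0
  set A := triangleSide s t ⁻¹' N ∩ Ioo 0 Real.pi with hA
  have hAm : MeasurableSet A := (hm hN).inter measurableSet_Ioo
  have h1 := lintegral_image_eq_lintegral_abs_deriv_mul hAm
    (fun φ hφ => (hasDerivAt_triangleSide hs ht hφ.2).hasDerivWithinAt)
    ((injOn_triangleSide hs ht).mono inter_subset_right) (fun _ => 1)
  have h2 : volume (triangleSide s t '' A) = 0 := by
    refine measure_mono_null ?_ h0
    rintro _ ⟨φ, hφ, rfl⟩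
    exact ⟨hφ.1, triangleSide_pos hs ht hφ.2⟩
  rw [setLIntegral_one, h2] at h1
  have hm2 : Measurable fun φ => ENNReal.ofReal |s * t * Real.sin φ / triangleSide s t φ| * 1 := by
    fun_prop
  have h3 := (setLIntegral_eq_zero_iff hAm hm2).1 h1.symm
  have h4 : ∀ᵐ φ : ℝ, φ ∉ A := by
    filter_upwards [h3] with φ hφ hmem
    have := hφ hmem
    have h5 := triangleSide_pos hs ht hmem.2
    have h6 := Real.sin_pos_of_pos_of_lt_pi hmem.2.1 hmem.2.2
    rw [mul_one, ENNReal.ofReal_eq_zero] at this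
    exact absurd this (not_le.2 (abs_pos.2 (by positivity)))
  simpa [ae_iff] using h4

theorem translatedPoint_apply {n : ℕ} (x y φ : Fin n → ℝ) (i : Fin n) :
    translatedPoint x y φ i = triangleSide (x i) (y i) (φ i) := rfl

theorem map_translatedPoint_absolutelyContinuous {n : ℕ} {γ : Fin n → ℝ}
    (hγ : ∀ i, 0 < γ i) {x y : Fin n → ℝ} (hx : x ∈ posOrthant n) (hy : y ∈ posOrthant n) :
    (cubeMeasure γ).map (translatedPoint x y) ≪ volume.restrict (posOrthant n) := by
  have hm : ∀ i, Measurable (triangleSide (x i) (y i)) := fun i =>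
    (continuous_triangleSide _ _).measurable
  have h0 : ∀ i, IsProbabilityMeasure (angleMeasure (γ i)) := fun i =>
    isProbabilityMeasure_angleMeasure (hγ i)
  have h1 : ∀ i, IsProbabilityMeasure
      ((angleMeasure (γ i)).map (triangleSide (x i) (y i))) := fun i =>
    Measure.isProbabilityMeasure_map (hm i).aemeasurable
  have h2 := Measure.pi_map_pi (μ := fun i => angleMeasure (γ i))
    (f := fun i => triangleSide (x i) (y i)) fun i => (hm i).aemeasurable
  have h3 : (univ.pi fun _ : Fin n => Ioi (0 : ℝ)) = posOrthant n := by
    ext x; simp [posOrthant]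
  have h4 : translatedPoint x y = fun φ i => triangleSide (x i) (y i) (φ i) := rfl
  rw [← h3, volume_pi, Measure.restrict_pi_pi, h4, cubeMeasure, h2]
  exact absolutelyContinuous_pi fun i =>
    map_triangleSide_absolutelyContinuous (hx i) (hy i) (γ i)

theorem ae_uniformSphere_mem {n : ℕ} (γ : Fin n → ℝ) :
    ∀ᵐ y ∂(uniformSphere γ), y ∈ posSphere n := by
  unfold uniformSphere weightedSphere
  refine Measure.ae_smul_measure ?_ _
  exact (withDensity_absolutelyContinuous _ _).ae_le (ae_restrict_mem (measurableSet_posSphere n))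

theorem ae_meanMeasure_mem {n : ℕ} {γ : Fin n → ℝ} (hγ : ∀ i, 0 < γ i) :
    ∀ᵐ p ∂(meanMeasure γ), p ∈ meanDomain n := by
  rw [meanMeasure_eq hγ]
  refine Measure.ae_smul_measure (Measure.ae_smul_measure ?_ _) _
  exact (withDensity_absolutelyContinuous _ _).ae_le (ae_restrict_mem (measurableSet_meanDomain n))

theorem translatedPoint_mem_posOrthant {n : ℕ} {x : Fin n → ℝ} (hx : x ∈ posOrthant n) {r : ℝ}
    (hr : 0 < r) {p : UnitSphere n × (Fin n → ℝ)} (hp : p ∈ meanDomain n) :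
    translatedPoint x (scaled r p.1) p.2 ∈ posOrthant n := fun i =>
  triangleSide_pos (hx i) (mul_pos hr (hp.1 i)) (hp.2 i (mem_univ i))

theorem measurable_meanPoint_right {n : ℕ} (x : Fin n → ℝ) (r : ℝ) :
    Measurable fun p : UnitSphere n × (Fin n → ℝ) => translatedPoint x (scaled r p.1) p.2 :=
  measurable_translatedPoint measurable_const (measurable_scaled (by fun_prop) (by fun_prop))
    (by fun_prop)

/-- This lets `f` be replaced by an almost everywhere equal Borel function at a fixed centre and
radius. For each fixed direction `y` the angles alone already give an absolutely continuous law, so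
no smoothness in `y` is needed. -/
theorem quasiMeasurePreserving_meanPoint {n : ℕ} {γ : Fin n → ℝ} (hγ : ∀ i, 0 < γ i)
    {x : Fin n → ℝ} (hx : x ∈ posOrthant n) {r : ℝ} (hr : 0 < r) :
    Measure.QuasiMeasurePreserving (fun p : UnitSphere n × (Fin n → ℝ) =>
      translatedPoint x (scaled r p.1) p.2) (meanMeasure γ) (volume.restrict (posOrthant n)) := by
  have hm := measurable_meanPoint_right x r
  refine ⟨hm, Measure.AbsolutelyContinuous.mk fun N hN h0 => ?_⟩
  rw [Measure.map_apply hm hN, meanMeasure, Measure.measure_prod_null (hm hN)]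
  filter_upwards [ae_uniformSphere_mem γ] with y hy
  have h1 := map_translatedPoint_absolutelyContinuous hγ hx (y := scaled r y)
    (fun i => mul_pos hr (hy i)) h0
  have h2 : Measurable (translatedPoint x (scaled r y)) :=
    measurable_translatedPoint measurable_const measurable_const measurable_id
  rwa [Measure.map_apply h2 hN] at h1

/-- The point at which the function is evaluated in an iterated mean. -/
def iteratedPoint {n : ℕ} (l m : ℝ) (x : Fin n → ℝ)
    (p : (UnitSphere n × (Fin n → ℝ)) × (UnitSphere n × (Fin n → ℝ))) : Fin n → ℝ :=
  translatedPoint (translatedPoint x (scaled l p.1.1) p.1.2) (scaled m p.2.1) p.2.2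

theorem measurable_iteratedPoint_right {n : ℕ} (l m : ℝ) (x : Fin n → ℝ) :
    Measurable (iteratedPoint l m x) :=
  measurable_translatedPoint (measurable_translatedPoint measurable_const
    (measurable_scaled (by fun_prop) (by fun_prop)) (by fun_prop))
    (measurable_scaled (by fun_prop) (by fun_prop)) (by fun_prop)

theorem quasiMeasurePreserving_iteratedPoint {n : ℕ} {γ : Fin n → ℝ} (hγ : ∀ i, 0 < γ i)
    {x : Fin n → ℝ} (hx : x ∈ posOrthant n) {l m : ℝ} (hl : 0 < l) (hm : 0 < m) :
    Measure.QuasiMeasurePreserving (iteratedPoint l m x)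
      ((meanMeasure γ).prod (meanMeasure γ)) (volume.restrict (posOrthant n)) := by
  have hmeas := measurable_iteratedPoint_right l m x
  refine ⟨hmeas, Measure.AbsolutelyContinuous.mk fun N hN h0 => ?_⟩
  rw [Measure.map_apply hmeas hN, Measure.measure_prod_null (hmeas hN)]
  filter_upwards [ae_meanMeasure_mem hγ] with p hp
  exact (quasiMeasurePreserving_meanPoint hγ
    (translatedPoint_mem_posOrthant hx hl hp) hm).preimage_null h0

/-! ### Absolute convergence -/

/-- With the weight `r^(n+|γ|-1)`, the radius and the direction together sweep out `y^γ dy` on the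
orthant, and translation by `x` preserves that measure. -/
theorem lintegral_mean_radial {n : ℕ} (hn : 0 < n) {γ : Fin n → ℝ} (hγ : ∀ i, 0 < γ i)
    (x : Fin n → ℝ) {F : (Fin n → ℝ) → ENNReal} (hF : Measurable F) :
    ∫⁻ r, ∫⁻ p, F (translatedPoint x (scaled r p.1) p.2) ∂(meanMeasure γ)
        ∂(powMeasure (effDim γ - 1))
      = ENNReal.ofReal (1 / sphereArea γ) * ∫⁻ z, F z ∂(orthantMeasure γ) := by
  have hm : Measurable fun q : (Fin n → ℝ) × (Fin n → ℝ) => F (translatedPoint x q.1 q.2) :=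
    hF.comp (measurable_translatedPoint measurable_const measurable_fst measurable_snd)
  have hmr : ∀ r : ℝ, Measurable fun p : UnitSphere n × (Fin n → ℝ) =>
      F (translatedPoint x (scaled r p.1) p.2) := fun r =>
    hF.comp (measurable_meanPoint_right x r)
  have hG : Measurable fun y => ∫⁻ φ, F (translatedPoint x y φ) ∂(cubeMeasure γ) :=
    hm.lintegral_prod_right'
  rw [← lintegral_translatedPoint hγ x hF, lintegral_orthantMeasure hn γ hG,
    ← lintegral_const_mul]
  · refine lintegral_congr fun r => ?_
    rw [meanMeasure, lintegral_prod _ (hmr r).aemeasurable, uniformSphere,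
      lintegral_smul_measure, smul_eq_mul]
  · exact (hG.comp (measurable_scaled measurable_fst measurable_snd)).lintegral_prod_right'

/-- The translated point is symmetric in centre and shift, so after Tonelli the centre is the
variable that gets translated, by the fixed vector `scaled r y`. -/
theorem lintegral_mean_orthant {n : ℕ} (hn : 0 < n) {γ : Fin n → ℝ} (hγ : ∀ i, 0 < γ i)
    (r : ℝ) {F : (Fin n → ℝ) → ENNReal} (hF : Measurable F) :
    ∫⁻ x, ∫⁻ p, F (translatedPoint x (scaled r p.1) p.2) ∂(meanMeasure γ) ∂(orthantMeasure γ)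
      = ∫⁻ z, F z ∂(orthantMeasure γ) := by
  have := isProbabilityMeasure_uniformSphere hn (γ := γ) fun i => by linarith [hγ i]
  have h1 : Measurable fun q : (Fin n → ℝ) × (UnitSphere n × (Fin n → ℝ)) =>
      F (translatedPoint q.1 (scaled r q.2.1) q.2.2) :=
    hF.comp (measurable_translatedPoint measurable_fst
      (measurable_scaled measurable_const (by fun_prop)) (by fun_prop))
  have h2 : ∀ x : Fin n → ℝ, ∫⁻ p, F (translatedPoint x (scaled r p.1) p.2) ∂(meanMeasure γ)
      = ∫⁻ y, ∫⁻ φ, F (translatedPoint (scaled r y) x φ) ∂(cubeMeasure γ)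
        ∂(uniformSphere γ) := by
    intro x
    have hm : Measurable fun p : UnitSphere n × (Fin n → ℝ) =>
        F (translatedPoint x (scaled r p.1) p.2) := hF.comp (measurable_meanPoint_right x r)
    rw [meanMeasure, lintegral_prod _ hm.aemeasurable]
    simp only [translatedPoint_comm x]
  simp only [h2]
  rw [lintegral_lintegral_swap]
  · simp only [lintegral_translatedPoint hγ _ hF, lintegral_const, measure_univ, mul_one]
  · have h3 : Measurable fun q : ((Fin n → ℝ) × UnitSphere n) × (Fin n → ℝ) =>
        F (translatedPoint (scaled r q.1.2) q.1.1 q.2) :=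
      hF.comp (measurable_translatedPoint (measurable_scaled measurable_const (by fun_prop))
        (by fun_prop) (by fun_prop))
    exact h3.lintegral_prod_right'.aemeasurable

theorem powWeight_pos {n : ℕ} (γ : Fin n → ℝ) {x : Fin n → ℝ} (hx : x ∈ posOrthant n) :
    0 < powWeight γ x := Finset.prod_pos fun i _ => Real.rpow_pos_of_pos (hx i) _

theorem integrable_orthantMeasure_iff {n : ℕ} (γ : Fin n → ℝ) (f : (Fin n → ℝ) → ℝ) :
    Integrable f (orthantMeasure γ) ↔
      IntegrableOn (fun x => f x * powWeight γ x) (posOrthant n) volume := by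
  rw [orthantMeasure_eq_withDensity]
  exact integrable_withDensity_ofReal_iff (measurableSet_posOrthant n) (measurable_powWeight γ)
    (fun x hx => powWeight_pos γ hx) f

theorem absolutelyContinuous_orthantMeasure {n : ℕ} (γ : Fin n → ℝ) :
    volume.restrict (posOrthant n) ≪ orthantMeasure γ := by
  have hw := measurable_powWeight γ
  rw [orthantMeasure_eq_withDensity]
  refine withDensity_absolutelyContinuous' (by fun_prop) ?_
  filter_upwards [ae_restrict_mem (measurableSet_posOrthant n)] with x hx
  simpa using powWeight_pos γ hx

theorem absolutelyContinuous_powMeasure (ν : ℝ) :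
    volume.restrict (Ioi 0) ≪ powMeasure ν := by
  refine withDensity_absolutelyContinuous' (by fun_prop) ?_
  filter_upwards [ae_restrict_mem measurableSet_Ioi] with x hx
  have hx : 0 < x := hx
  simpa using Real.rpow_pos_of_pos hx ν

theorem meanConverges_iff_of_ae_eq {n : ℕ} (hn : 0 < n) {γ : Fin n → ℝ} (hγ : ∀ i, 0 < γ i)
    {f g : (Fin n → ℝ) → ℝ} (hg : StronglyMeasurable g)
    (h : f =ᵐ[volume.restrict (posOrthant n)] g) {x : Fin n → ℝ} (hx : x ∈ posOrthant n)
    {r : ℝ} (hr : 0 < r) :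
    MeanConverges γ r f x ↔
      ∫⁻ p, ‖g (translatedPoint x (scaled r p.1) p.2)‖ₑ ∂(meanMeasure γ) < ⊤ := by
  rw [meanConverges_iff hn hγ]
  refine (integrable_congr ((quasiMeasurePreserving_meanPoint hγ hx hr).ae_eq h)).trans ?_
  exact ⟨fun h => h.2, fun h =>
    ⟨(hg.comp_measurable (measurable_meanPoint_right x r)).aestronglyMeasurable, h⟩⟩

theorem iteratedMeanConverges_iff_of_ae_eq {n : ℕ} (hn : 0 < n) {γ : Fin n → ℝ}
    (hγ : ∀ i, 0 < γ i) {f g : (Fin n → ℝ) → ℝ} (hg : StronglyMeasurable g)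
    (h : f =ᵐ[volume.restrict (posOrthant n)] g) {x : Fin n → ℝ} (hx : x ∈ posOrthant n)
    {l m : ℝ} (hl : 0 < l) (hm : 0 < m) :
    IteratedMeanConverges γ l m f x ↔
      ∫⁻ p, ‖g (iteratedPoint l m x p)‖ₑ ∂((meanMeasure γ).prod (meanMeasure γ)) < ⊤ := by
  rw [iteratedMeanConverges_iff hn hγ]
  refine (integrable_congr
    ((quasiMeasurePreserving_iteratedPoint hγ hx hl hm).ae_eq h)).trans ?_
  exact ⟨fun h => h.2, fun h =>
    ⟨(hg.comp_measurable (measurable_iteratedPoint_right l m x)).aestronglyMeasurable, h⟩⟩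

theorem measurable_lintegral_mean {n : ℕ} (γ : Fin n → ℝ) (r : ℝ)
    {F : (Fin n → ℝ) → ENNReal} (hF : Measurable F) :
    Measurable fun x => ∫⁻ p, F (translatedPoint x (scaled r p.1) p.2) ∂(meanMeasure γ) := by
  have h1 : Measurable fun q : (Fin n → ℝ) × (UnitSphere n × (Fin n → ℝ)) =>
      F (translatedPoint q.1 (scaled r q.2.1) q.2.2) :=
    hF.comp (measurable_translatedPoint measurable_fst
      (measurable_scaled measurable_const (by fun_prop)) (by fun_prop))
  exact h1.lintegral_prod_right'

theorem lintegral_iteratedPoint {n : ℕ} (γ : Fin n → ℝ) (l m : ℝ) (x : Fin n → ℝ)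
    {F : (Fin n → ℝ) → ENNReal} (hF : Measurable F) :
    ∫⁻ p, F (iteratedPoint l m x p) ∂((meanMeasure γ).prod (meanMeasure γ))
      = ∫⁻ p, ∫⁻ q, F (translatedPoint (translatedPoint x (scaled l p.1) p.2)
          (scaled m q.1) q.2) ∂(meanMeasure γ) ∂(meanMeasure γ) :=
  lintegral_prod _ (hF.comp (measurable_iteratedPoint_right l m x)).aemeasurable

theorem ae_meanConverges {n : ℕ} (hn : 0 < n) {γ : Fin n → ℝ} (hγ : ∀ i, 0 < γ i)
    {f : (Fin n → ℝ) → ℝ} (hf : Integrable f (orthantMeasure γ)) {x : Fin n → ℝ}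
    (hx : x ∈ posOrthant n) :
    ∀ᵐ r ∂(volume.restrict (Ioi (0 : ℝ))), MeanConverges γ r f x := by
  have hg := hf.1.stronglyMeasurable_mk
  have hfg := (absolutelyContinuous_orthantMeasure γ).ae_eq hf.1.ae_eq_mk
  set g := hf.1.mk f
  have hF : Measurable fun z => ‖g z‖ₑ := hg.measurable.enorm
  have h1 := lintegral_mean_radial hn hγ x hF
  have h2 : ∫⁻ z, ‖g z‖ₑ ∂(orthantMeasure γ) < ⊤ := (hf.congr hf.1.ae_eq_mk).2
  have h3 : Measurable fun r => ∫⁻ p, ‖g (translatedPoint x (scaled r p.1) p.2)‖ₑ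
      ∂(meanMeasure γ) := by
    have : Measurable fun q : ℝ × (UnitSphere n × (Fin n → ℝ)) =>
        ‖g (translatedPoint x (scaled q.1 q.2.1) q.2.2)‖ₑ :=
      hF.comp (measurable_translatedPoint measurable_const
        (measurable_scaled (by fun_prop) (by fun_prop)) (by fun_prop))
    exact this.lintegral_prod_right'
  have h4 := ae_lt_top h3 (by rw [h1]; exact ENNReal.mul_ne_top (by simp) h2.ne)
  filter_upwards [ae_restrict_mem measurableSet_Ioi,
    (absolutelyContinuous_powMeasure _).ae_le h4] with r hr h
  exact (meanConverges_iff_of_ae_eq hn hγ hg hfg hx hr).2 h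

theorem ae_iteratedMeanConverges {n : ℕ} (hn : 0 < n) {γ : Fin n → ℝ} (hγ : ∀ i, 0 < γ i)
    {f : (Fin n → ℝ) → ℝ} (hf : Integrable f (orthantMeasure γ)) {l m : ℝ} (hl : 0 < l)
    (hm : 0 < m) :
    ∀ᵐ x ∂(volume.restrict (posOrthant n)), IteratedMeanConverges γ l m f x := by
  have hg := hf.1.stronglyMeasurable_mk
  have hfg := (absolutelyContinuous_orthantMeasure γ).ae_eq hf.1.ae_eq_mk
  set g := hf.1.mk f
  have hF : Measurable fun z => ‖g z‖ₑ := hg.measurable.enorm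
  have h2 : ∫⁻ z, ‖g z‖ₑ ∂(orthantMeasure γ) < ⊤ := (hf.congr hf.1.ae_eq_mk).2
  have hG := measurable_lintegral_mean γ m hF
  -- Each of the two means preserves the integral over the orthant.
  have h4 := ae_lt_top (measurable_lintegral_mean γ l hG)
    (by rw [lintegral_mean_orthant hn hγ l hG, lintegral_mean_orthant hn hγ m hF]; exact h2.ne)
  filter_upwards [ae_restrict_mem (measurableSet_posOrthant n),
    (absolutelyContinuous_orthantMeasure γ).ae_le h4] with x hx h
  rw [iteratedMeanConverges_iff_of_ae_eq hn hγ hg hfg hx hl hm, lintegral_iteratedPoint _ _ _ _ hF]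
  exact h

/-- The inner mean of `|f|` is integrable over the orthant by invariance, and the outer mean is then
integrated over its radius. Only the outer radius can be treated this way; the inner one is reached
through the symmetry `iteratedMeanConverges_comm`. -/
theorem ae_iteratedMeanConverges_left {n : ℕ} (hn : 0 < n) {γ : Fin n → ℝ}
    (hγ : ∀ i, 0 < γ i) {f : (Fin n → ℝ) → ℝ} (hf : Integrable f (orthantMeasure γ))
    {x : Fin n → ℝ} (hx : x ∈ posOrthant n) {m : ℝ} (hm : 0 < m) :
    ∀ᵐ l ∂(volume.restrict (Ioi (0 : ℝ))), IteratedMeanConverges γ l m f x := by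
  have hg := hf.1.stronglyMeasurable_mk
  have hfg := (absolutelyContinuous_orthantMeasure γ).ae_eq hf.1.ae_eq_mk
  set g := hf.1.mk f
  have hF : Measurable fun z => ‖g z‖ₑ := hg.measurable.enorm
  have h2 : ∫⁻ z, ‖g z‖ₑ ∂(orthantMeasure γ) < ⊤ := (hf.congr hf.1.ae_eq_mk).2
  have hG := measurable_lintegral_mean γ m hF
  have h1 := lintegral_mean_radial hn hγ x hG
  rw [lintegral_mean_orthant hn hγ m hF] at h1
  have h3 : Measurable fun r => ∫⁻ p, (fun z => ∫⁻ q, ‖g (translatedPoint z (scaled m q.1) q.2)‖ₑ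
      ∂(meanMeasure γ)) (translatedPoint x (scaled r p.1) p.2) ∂(meanMeasure γ) := by
    have := hG.comp (measurable_translatedPoint
      (α := ℝ × (UnitSphere n × (Fin n → ℝ))) (measurable_const (a := x))
        (measurable_scaled (y := fun q => q.2.1) measurable_fst (by fun_prop))
        (φ := fun q => q.2.2) (by fun_prop))
    exact this.lintegral_prod_right'
  have h4 := ae_lt_top h3 (by rw [h1]; exact ENNReal.mul_ne_top (by simp) h2.ne)
  filter_upwards [ae_restrict_mem measurableSet_Ioi,
    (absolutelyContinuous_powMeasure _).ae_le h4] with l hl h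
  rw [iteratedMeanConverges_iff_of_ae_eq hn hγ hg hfg hx hl hm, lintegral_iteratedPoint _ _ _ _ hF]
  exact h

/-! ### The one-dimensional translation of even powers -/

theorem integral_withDensity_ofReal {α : Type*} [MeasurableSpace α] {μ : Measure α}
    {s : Set α} (hs : MeasurableSet s) {w : α → ℝ} (hw : Measurable w)
    (hp : ∀ a ∈ s, 0 < w a) (f : α → ℝ) :
    ∫ a, f a ∂((μ.restrict s).withDensity fun a => ENNReal.ofReal (w a))
      = ∫ a in s, f a * w a ∂μ := by
  rw [integral_withDensity_eq_integral_toReal_smul (by fun_prop) (by simp)]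
  refine setIntegral_congr_fun hs fun a ha => ?_
  simp only [ENNReal.toReal_ofReal (hp a ha).le, smul_eq_mul, mul_comm]

theorem integral_angleMeasure {ν : ℝ} (hν : 0 < ν) (g : ℝ → ℝ) :
    ∫ φ, g φ ∂(angleMeasure ν)
      = angleConst ν * ∫ φ in (0 : ℝ)..Real.pi, g φ * Real.sin φ ^ (ν - 1) := by
  rw [angleMeasure, integral_smul_measure, ENNReal.toReal_ofReal (angleConst_pos hν).le,
    smul_eq_mul, sinMeasure, integral_withDensity_ofReal measurableSet_Ioo (by fun_prop)
      (fun φ hφ => Real.rpow_pos_of_pos (Real.sin_pos_of_pos_of_lt_pi hφ.1 hφ.2) _),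
    intervalIntegral.integral_of_le Real.pi_pos.le, integral_Ioc_eq_integral_Ioo]

theorem genTranslation_eq {ν : ℝ} (hν : 0 < ν) (t : ℝ) (g : ℝ → ℝ) (s : ℝ) :
    genTranslation ν t g s = ∫ φ, g (triangleSide s t φ) ∂(angleMeasure ν) :=
  (integral_angleMeasure hν _).symm

theorem integrable_angleMeasure_iff {ν : ℝ} (hν : 0 < ν) (g : ℝ → ℝ) :
    Integrable g (angleMeasure ν) ↔
      IntervalIntegrable (fun φ => g φ * Real.sin φ ^ (ν - 1)) volume 0 Real.pi := by
  have hc := angleConst_pos hν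
  unfold angleMeasure
  rw [integrable_smul_measure (by simpa using hc) (by simp), sinMeasure,
    integrable_withDensity_ofReal_iff measurableSet_Ioo (by fun_prop)
      (fun φ hφ => Real.rpow_pos_of_pos (Real.sin_pos_of_pos_of_lt_pi hφ.1 hφ.2) _),
    intervalIntegrable_iff_integrableOn_Ioo_of_le Real.pi_pos.le]

theorem integrable_angleMeasure_of_continuous {ν : ℝ} (hν : 0 < ν) {g : ℝ → ℝ}
    (hg : Continuous g) : Integrable g (angleMeasure ν) := by
  have := isProbabilityMeasure_angleMeasure hν
  obtain ⟨C, hC⟩ := isCompact_Icc.exists_bound_of_continuousOn (s := Icc 0 Real.pi)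
    hg.continuousOn
  refine Integrable.of_bound hg.aestronglyMeasurable C ?_
  filter_upwards [ae_angleMeasure_mem ν] with φ hφ
  exact hC φ ⟨hφ.1.le, hφ.2.le⟩

/-- The integrand times `sin^(ν-1) φ` is the derivative of `w^k sin^ν φ`, with `w` the squared side;
the boundary terms vanish because `ν > 0`. -/
theorem integral_angleMeasure_ibp {ν : ℝ} (hν : 0 < ν) (s t : ℝ) (k : ℕ) :
    ∫ φ, (k * (triangleSide s t φ ^ 2) ^ (k - 1) * (2 * s * t * Real.sin φ ^ 2)
      + ν * (triangleSide s t φ ^ 2) ^ k * Real.cos φ) ∂(angleMeasure ν) = 0 := by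
  have hside := continuous_triangleSide s t
  have hint := (integrable_angleMeasure_iff hν _).1 (integrable_angleMeasure_of_continuous hν
    (g := fun φ => (k * (triangleSide s t φ ^ 2) ^ (k - 1) * (2 * s * t * Real.sin φ ^ 2)
      + ν * (triangleSide s t φ ^ 2) ^ k * Real.cos φ)) (by fun_prop))
  rw [integral_angleMeasure hν, intervalIntegral.integral_eq_sub_of_hasDerivAt_of_le
    (f := fun φ => (triangleSide s t φ ^ 2) ^ k * Real.sin φ ^ ν) Real.pi_pos.le _ _ hint]
  · simp [Real.zero_rpow hν.ne']
  · exact ContinuousOn.mul (by fun_prop)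
      (ContinuousOn.rpow_const (by fun_prop) fun _ _ => Or.inr hν.le)
  · intro φ hφ
    have hs := Real.sin_pos_of_pos_of_lt_pi hφ.1 hφ.2
    simp only [triangleSide_sq]
    have h1 : HasDerivAt (fun φ => s ^ 2 + t ^ 2 - 2 * s * t * Real.cos φ)
        (-(2 * s * t * -Real.sin φ)) φ :=
      ((Real.hasDerivAt_cos φ).const_mul _).const_sub _
    have h2 := (h1.fun_pow k).mul ((Real.hasDerivAt_sin φ).rpow_const (p := ν) (Or.inl hs.ne'))
    refine h2.congr_deriv ?_
    rw [Real.rpow_sub_one hs.ne']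
    field_simp

/-- The `k`-th moment of the squared third side. -/
def sideMoment (ν s t : ℝ) (k : ℕ) : ℝ := ∫ φ, (triangleSide s t φ ^ 2) ^ k ∂(angleMeasure ν)

theorem integrable_sideMoment {ν : ℝ} (hν : 0 < ν) (s t : ℝ) (k : ℕ) :
    Integrable (fun φ => (triangleSide s t φ ^ 2) ^ k) (angleMeasure ν) := by
  have hside := continuous_triangleSide s t
  exact integrable_angleMeasure_of_continuous hν (by fun_prop)

theorem sideMoment_zero {ν : ℝ} (hν : 0 < ν) (s t : ℝ) : sideMoment ν s t 0 = 1 := by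
  have := isProbabilityMeasure_angleMeasure hν
  simp [sideMoment]

theorem sideMoment_one {ν : ℝ} (hν : 0 < ν) (s t : ℝ) :
    sideMoment ν s t 1 = s ^ 2 + t ^ 2 := by
  have := isProbabilityMeasure_angleMeasure hν
  have h := integral_angleMeasure_ibp hν s t 0
  simp only [Nat.cast_zero, zero_mul, pow_zero, mul_one, zero_add, integral_const_mul] at h
  have h0 := (mul_eq_zero.1 h).resolve_left hν.ne'
  have hi : Integrable Real.cos (angleMeasure ν) :=
    integrable_angleMeasure_of_continuous hν Real.continuous_cos
  simp only [sideMoment, pow_one, triangleSide_sq]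
  rw [integral_sub (integrable_const _) (hi.const_mul _), integral_const_mul, h0]
  simp

/-- Multiply the integrated-by-parts identity for `k + 1` by `2st`. The law of cosines then
expresses both `2st cos φ` and `(2st sin φ)²` as polynomials in the squared side. -/
theorem sideMoment_add_two {ν : ℝ} (hν : 0 < ν) (s t : ℝ) (k : ℕ) :
    (k + 1 + ν) * sideMoment ν s t (k + 2)
      = (s ^ 2 + t ^ 2) * (2 * (k + 1) + ν) * sideMoment ν s t (k + 1)
        - (k + 1) * (s ^ 2 - t ^ 2) ^ 2 * sideMoment ν s t k := by
  have h := integral_angleMeasure_ibp hν s t (k + 1)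
  have h1 : ∀ φ, 2 * s * t * (((k + 1 : ℕ) : ℝ) * (triangleSide s t φ ^ 2) ^ (k + 1 - 1) *
        (2 * s * t * Real.sin φ ^ 2) + ν * (triangleSide s t φ ^ 2) ^ (k + 1) * Real.cos φ)
      = (s ^ 2 + t ^ 2) * (2 * (k + 1) + ν) * (triangleSide s t φ ^ 2) ^ (k + 1)
        - (k + 1) * (s ^ 2 - t ^ 2) ^ 2 * (triangleSide s t φ ^ 2) ^ k
        - (k + 1 + ν) * (triangleSide s t φ ^ 2) ^ (k + 2) := by
    intro φ
    have e1 : 2 * s * t * Real.cos φ = s ^ 2 + t ^ 2 - triangleSide s t φ ^ 2 := by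
      rw [triangleSide_sq]; ring
    have e2 : (2 * s * t) ^ 2 * Real.sin φ ^ 2
        = (2 * s * t) ^ 2 - (s ^ 2 + t ^ 2 - triangleSide s t φ ^ 2) ^ 2 := by
      rw [← e1, Real.sin_sq]; ring
    set w := triangleSide s t φ ^ 2
    rw [Nat.add_sub_cancel]
    push_cast
    linear_combination (k + 1) * w ^ k * e2 + ν * w ^ (k + 1) * e1
  have hi := integrable_sideMoment hν s t
  have h2 : (0 : ℝ) = 2 * s * t * 0 := by ring
  rw [← h, ← integral_const_mul] at h2
  simp only [h1] at h2
  have hi2 : Integrable (fun φ => (s ^ 2 + t ^ 2) * (2 * (k + 1) + ν) *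
      (triangleSide s t φ ^ 2) ^ (k + 1) - (k + 1) * (s ^ 2 - t ^ 2) ^ 2 *
      (triangleSide s t φ ^ 2) ^ k) (angleMeasure ν) :=
    ((hi (k + 1)).const_mul _).sub ((hi k).const_mul _)
  rw [h, integral_sub hi2 ((hi (k + 2)).const_mul _),
    integral_sub ((hi (k + 1)).const_mul _) ((hi k).const_mul _), integral_const_mul,
    integral_const_mul, integral_const_mul] at h2
  unfold sideMoment
  linarith

/-- The coefficients of the normalized Bessel functions: `besselCoeff ν k * s ^ (2 k)` is mapped
to its predecessor by the Bessel operator of order `ν`. -/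
def besselCoeff (ν : ℝ) (k : ℕ) : ℝ :=
  Real.Gamma ((ν + 1) / 2) / (4 ^ k * k.factorial * Real.Gamma (k + (ν + 1) / 2))

theorem besselCoeff_zero {ν : ℝ} (hν : 0 < ν) : besselCoeff ν 0 = 1 := by
  have := Real.Gamma_pos_of_pos (s := (ν + 1) / 2) (by linarith)
  simp [besselCoeff, this.ne']

theorem besselCoeff_pos {ν : ℝ} (hν : 0 < ν) (k : ℕ) : 0 < besselCoeff ν k := by
  have h1 := Real.Gamma_pos_of_pos (s := (ν + 1) / 2) (by linarith)
  have h2 := Real.Gamma_pos_of_pos (s := k + (ν + 1) / 2) (by positivity)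
  unfold besselCoeff
  positivity

theorem besselCoeff_succ {ν : ℝ} (hν : 0 < ν) (k : ℕ) :
    2 * (k + 1 : ℝ) * (2 * (k + 1) - 1 + ν) * besselCoeff ν (k + 1) = besselCoeff ν k := by
  have h2 := Real.Gamma_pos_of_pos (s := k + (ν + 1) / 2) (by positivity)
  have h3 : Real.Gamma ((k + 1 : ℕ) + (ν + 1) / 2)
      = (k + (ν + 1) / 2) * Real.Gamma (k + (ν + 1) / 2) := by
    rw [← Real.Gamma_add_one (by positivity)]
    congr 1
    push_cast
    ring
  unfold besselCoeff
  rw [h3, pow_succ, Nat.factorial_succ]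
  have : (k + (ν + 1) / 2 : ℝ) ≠ 0 := by positivity
  have : (k : ℝ) * 2 + ν + 1 ≠ 0 := by positivity
  push_cast
  field_simp
  ring

/-- Sums over an antidiagonal of products of Bessel coefficients, with polynomial weights. -/
def antidiagonalSum (ν X Y : ℝ) (k : ℕ) (p : ℝ → ℝ → ℝ) : ℝ :=
  ∑ q ∈ Finset.HasAntidiagonal.antidiagonal k,
    p q.1 q.2 * ((besselCoeff ν q.1 * X ^ q.1) * (besselCoeff ν q.2 * Y ^ q.2))

/-- A factor `X` raises the first index, at the cost of the weight `2a(2a-1+ν)` from the recursion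
of the coefficients. That weight vanishes at `a = 0`, so the new boundary term of the longer
antidiagonal is free. -/
theorem mul_antidiagonalSum_left {ν : ℝ} (hν : 0 < ν) (X Y : ℝ) (k : ℕ) (p : ℝ → ℝ → ℝ) :
    X * antidiagonalSum ν X Y k p
      = antidiagonalSum ν X Y (k + 1) fun a b => p (a - 1) b * (2 * a * (2 * a - 1 + ν)) := by
  unfold antidiagonalSum
  rw [Finset.Nat.antidiagonal_succ, Finset.sum_cons, Finset.sum_map, Finset.mul_sum]
  simp only [Nat.cast_zero, mul_zero, zero_mul, zero_add]
  refine Finset.sum_congr rfl fun q _ => ?_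
  simp only [Function.Embedding.prodMap, Function.Embedding.coeFn_mk, Prod.map,
    Function.Embedding.refl_apply, Nat.succ_eq_add_one]
  rw [← besselCoeff_succ hν q.1]
  push_cast
  rw [add_sub_cancel_right]
  ring

theorem mul_antidiagonalSum_right {ν : ℝ} (hν : 0 < ν) (X Y : ℝ) (k : ℕ) (p : ℝ → ℝ → ℝ) :
    Y * antidiagonalSum ν X Y k p
      = antidiagonalSum ν X Y (k + 1) fun a b => p a (b - 1) * (2 * b * (2 * b - 1 + ν)) := by
  unfold antidiagonalSum
  rw [Finset.Nat.antidiagonal_succ', Finset.sum_cons, Finset.sum_map, Finset.mul_sum]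
  simp only [Nat.cast_zero, mul_zero, zero_mul, zero_add]
  refine Finset.sum_congr rfl fun q _ => ?_
  simp only [Function.Embedding.prodMap, Function.Embedding.coeFn_mk, Prod.map,
    Function.Embedding.refl_apply, Nat.succ_eq_add_one]
  rw [← besselCoeff_succ hν q.2]
  push_cast
  rw [add_sub_cancel_right]
  ring

/-- Once all factors `X` and `Y` are absorbed, every sum runs over the same antidiagonal, and the
claim becomes a polynomial identity in the two indices, whose sum is `k + 2`. -/
theorem antidiagonalSum_add_two {ν : ℝ} (hν : 0 < ν) (X Y : ℝ) (k : ℕ) :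
    2 * (2 * k + 1 + ν) * (2 * (k + 2) * (2 * (k + 2) - 1 + ν)) * (k + 1 + ν) *
        antidiagonalSum ν X Y (k + 2) (fun _ _ => 1)
      = 2 * (2 * k + 1 + ν) * (2 * (k + 1) + ν) * (X + Y) *
          antidiagonalSum ν X Y (k + 1) (fun _ _ => 1)
        - (X - Y) ^ 2 * antidiagonalSum ν X Y k fun _ _ => 1 := by
  have e : 2 * (2 * k + 1 + ν) * (2 * (k + 1) + ν) * (X + Y) *
          antidiagonalSum ν X Y (k + 1) (fun _ _ => 1)
        - (X - Y) ^ 2 * antidiagonalSum ν X Y k (fun _ _ => 1)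
      = 2 * (2 * k + 1 + ν) * (2 * (k + 1) + ν) *
          (X * antidiagonalSum ν X Y (k + 1) (fun _ _ => 1)
            + Y * antidiagonalSum ν X Y (k + 1) (fun _ _ => 1))
        - (X * (X * antidiagonalSum ν X Y k fun _ _ => 1)
          - 2 * (X * (Y * antidiagonalSum ν X Y k fun _ _ => 1))
          + Y * (Y * antidiagonalSum ν X Y k fun _ _ => 1)) := by ring
  rw [e]
  simp only [mul_antidiagonalSum_left hν, mul_antidiagonalSum_right hν]
  unfold antidiagonalSum
  simp only [Finset.mul_sum, ← Finset.sum_add_distrib, ← Finset.sum_sub_distrib]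
  refine Finset.sum_congr rfl fun q hq => ?_
  have h : (q.1 : ℝ) + q.2 = k + 2 := by exact_mod_cast Finset.HasAntidiagonal.mem_antidiagonal.1 hq
  have hk : (k : ℝ) = q.1 + q.2 - 2 := by linarith
  rw [hk]
  ring

/-- Both sides satisfy the same three-term recursion with the same first two values. This is the
product formula for normalized Bessel functions, taken one coefficient at a time. -/
theorem besselCoeff_mul_sideMoment {ν : ℝ} (hν : 0 < ν) (s t : ℝ) (k : ℕ) :
    besselCoeff ν k * sideMoment ν s t k
      = antidiagonalSum ν (s ^ 2) (t ^ 2) k fun _ _ => 1 := by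
  induction k using Nat.strong_induction_on with
  | _ k ih =>
    match k with
    | 0 => simp [antidiagonalSum, sideMoment_zero hν, besselCoeff_zero hν]
    | 1 =>
      have : Finset.HasAntidiagonal.antidiagonal 1 = {((0 : ℕ), (1 : ℕ)), (1, 0)} := rfl
      simp [antidiagonalSum, sideMoment_one hν, besselCoeff_zero hν, this]
      ring
    | k + 2 =>
      have h0 := ih k (by omega)
      have h1 := ih (k + 1) (by omega)
      have h2 := antidiagonalSum_add_two hν (s ^ 2) (t ^ 2) k
      rw [← h0, ← h1] at h2
      have h3 := sideMoment_add_two hν s t k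
      have c0 := besselCoeff_succ hν k
      have c1 := besselCoeff_succ hν (k + 1)
      push_cast at c1
      have hpos : 2 * (2 * k + 1 + ν) * (2 * (k + 2) * (2 * (k + 2) - 1 + ν)) * (k + 1 + ν) ≠ 0 := by
        have : 0 < 2 * ((k : ℝ) + 2) - 1 + ν := by
          have : (0 : ℝ) ≤ k := by positivity
          linarith
        positivity
      refine mul_left_cancel₀ hpos ?_
      rw [h2]
      have c1' : 2 * ((k : ℝ) + 2) * (2 * (k + 2) - 1 + ν) * besselCoeff ν (k + 2)
          = besselCoeff ν (k + 1) := by rw [← c1]; ring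
      rw [← c0]
      linear_combination 2 * (2 * k + 1 + ν) * besselCoeff ν (k + 1) * h3
        + 2 * (2 * k + 1 + ν) * (k + 1 + ν) * sideMoment ν s t (k + 2) * c1'

/-- The even powers, normalized. -/
def besselMonomial (ν : ℝ) (k : ℕ) (s : ℝ) : ℝ := besselCoeff ν k * (s ^ 2) ^ k

theorem integral_besselMonomial {ν : ℝ} (hν : 0 < ν) (s t : ℝ) (k : ℕ) :
    ∫ φ, besselMonomial ν k (triangleSide s t φ) ∂(angleMeasure ν)
      = ∑ q ∈ Finset.HasAntidiagonal.antidiagonal k, besselMonomial ν q.1 s * besselMonomial ν q.2 t := by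
  have h := besselCoeff_mul_sideMoment hν s t k
  unfold besselMonomial
  rw [integral_const_mul]
  simpa [antidiagonalSum, sideMoment] using h

/-! ### Compactly supported measures with equal even moments -/

theorem integrable_comp_of_mem_compact {α E : Type*} [MeasurableSpace α] [TopologicalSpace E]
    [MeasurableSpace E] [BorelSpace E] {μ : Measure α} [IsFiniteMeasure μ] {T : α → E}
    (hT : Measurable T) {K : Set E} (hK : IsCompact K) (hTK : ∀ᵐ a ∂μ, T a ∈ K) {g : E → ℝ}
    (hg : Continuous g) : Integrable (fun a => g (T a)) μ := by
  obtain ⟨C, hC⟩ := hK.exists_bound_of_continuousOn hg.continuousOn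
  refine Integrable.of_bound (hg.measurable.comp hT).aestronglyMeasurable C ?_
  filter_upwards [hTK] with a ha
  exact hC _ ha

/-- Even moments suffice because the box lies in the closed orthant, where a point is determined by
the squares of its coordinates. Polynomials in those squares are then uniformly dense in the
continuous functions on the box. -/
theorem measure_eq_of_even_moments {n : ℕ} {P Q : Measure (Fin n → ℝ)} [IsFiniteMeasure P]
    [IsFiniteMeasure Q] {R : Fin n → ℝ} (hP : ∀ᵐ z ∂P, z ∈ Icc 0 R) (hQ : ∀ᵐ z ∂Q, z ∈ Icc 0 R)
    (h : ∀ α : Fin n →₀ ℕ, ∫ z, ∏ i, (z i ^ 2) ^ α i ∂P = ∫ z, ∏ i, (z i ^ 2) ^ α i ∂Q) :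
    P = Q := by
  have hK : IsCompact (Icc (0 : Fin n → ℝ) R) := isCompact_Icc
  have : CompactSpace (Icc (0 : Fin n → ℝ) R) := isCompact_iff_compactSpace.1 hK
  refine ext_of_forall_integral_eq_of_IsFiniteMeasure fun g => ?_
  let s : Fin n → C(Icc (0 : Fin n → ℝ) R, ℝ) := fun i => 
    ⟨fun z => z.1 i ^ 2, ((continuous_apply i).comp continuous_subtype_val).pow 2⟩
  have hsep : (Algebra.adjoin ℝ (range s)).SeparatesPoints := by
    intro z w hzw
    have : ∃ i, z.1 i ≠ w.1 i := by
      by_contra hc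
      push Not at hc
      exact hzw (Subtype.ext (funext hc))
    obtain ⟨i, hi⟩ := this
    refine ⟨s i, ⟨s i, Algebra.subset_adjoin ⟨i, rfl⟩, rfl⟩, fun he => hi ?_⟩
    exact (pow_left_inj₀ (z.2.1 i) (w.2.1 i) two_ne_zero).1 he
  have hpoly : ∀ q : MvPolynomial (Fin n) ℝ,
      ∫ z, MvPolynomial.eval (fun i => z i ^ 2) q ∂P
        = ∫ z, MvPolynomial.eval (fun i => z i ^ 2) q ∂Q := by
    intro q
    simp only [MvPolynomial.eval_eq']
    rw [integral_finsetSum, integral_finsetSum]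
    · refine Finset.sum_congr rfl fun α _ => ?_
      rw [integral_const_mul, integral_const_mul, h]
    · intro α _
      exact integrable_comp_of_mem_compact measurable_id hK hQ
        (g := fun z => MvPolynomial.coeff α q * ∏ i, (z i ^ 2) ^ α i) (by fun_prop)
    · intro α _
      exact integrable_comp_of_mem_compact measurable_id hK hP
        (g := fun z => MvPolynomial.coeff α q * ∏ i, (z i ^ 2) ^ α i) (by fun_prop)
  have key : ∀ ε > 0, |∫ z, g z ∂P - ∫ z, g z ∂Q| ≤ ε * (P.real univ + Q.real univ) := by
    intro ε hε
    obtain ⟨⟨p, hp⟩, hpg⟩ :=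
      ContinuousMap.exists_mem_subalgebra_near_continuousMap_of_separatesPoints
        (Algebra.adjoin ℝ (range s)) hsep ⟨fun z => g z.1, by fun_prop⟩ ε hε
    rw [Algebra.adjoin_range_eq_range_aeval] at hp
    obtain ⟨q, rfl⟩ := hp
    have hcont : Continuous fun z : Fin n → ℝ => MvPolynomial.eval (fun i => z i ^ 2) q := by
      simp only [MvPolynomial.eval_eq']
      fun_prop
    have hb : ∀ z ∈ Icc (0 : Fin n → ℝ) R,
        |MvPolynomial.eval (fun i => z i ^ 2) q - g z| ≤ ε := by
      intro z hz
      have h1 := (ContinuousMap.norm_coe_le_norm _ (⟨z, hz⟩ : Icc (0 : Fin n → ℝ) R)).trans hpg.le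
      have h2 : (MvPolynomial.aeval s q) ⟨z, hz⟩ = MvPolynomial.eval (fun i => z i ^ 2) q := by
        have := MvPolynomial.comp_aeval_apply (R := ℝ) s
          (ContinuousMap.evalAlgHom ℝ ℝ (⟨z, hz⟩ : Icc (0 : Fin n → ℝ) R)) q
        rw [MvPolynomial.aeval_eq_eval] at this
        exact this
      rw [← h2]
      exact h1
    have hμ : ∀ μ : Measure (Fin n → ℝ), IsFiniteMeasure μ → (∀ᵐ z ∂μ, z ∈ Icc 0 R) →
        |∫ z, MvPolynomial.eval (fun i => z i ^ 2) q ∂μ - ∫ z, g z ∂μ| ≤ ε * μ.real univ := by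
      intro μ _ hμK
      have h1 : Integrable (fun z => MvPolynomial.eval (fun i => z i ^ 2) q) μ :=
        integrable_comp_of_mem_compact measurable_id hK hμK hcont
      have h2 : Integrable (fun z => g z) μ :=
        integrable_comp_of_mem_compact measurable_id hK hμK g.continuous
      rw [← integral_sub h1 h2, ← Real.norm_eq_abs]
      refine norm_integral_le_of_norm_le_const (μ := μ) ?_
      filter_upwards [hμK] with z hz
      exact hb z hz
    have h1 := hμ P inferInstance hP
    have h2 := hμ Q inferInstance hQ
    rw [hpoly] at h1
    rw [abs_le] at *
    constructor <;> linarith [h1.1, h1.2, h2.1, h2.2]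
  have hz : |∫ z, g z ∂P - ∫ z, g z ∂Q| ≤ 0 := by
    refine le_of_forall_pos_le_add fun δ hδ => ?_
    have hpos : 0 ≤ P.real univ + Q.real univ := by positivity
    -- The `+ 1` keeps the denominator positive when both measures vanish.
    refine (key (δ / (P.real univ + Q.real univ + 1)) (by positivity)).trans ?_
    rw [zero_add, div_mul_eq_mul_div, div_le_iff₀ (by positivity)]
    nlinarith
  exact sub_eq_zero.1 (abs_nonpos_iff.1 hz)

/-! ### Spherical means of even monomials -/

/-- The even monomials, normalized. -/
def besselProd {n : ℕ} (γ : Fin n → ℝ) (α : Fin n →₀ ℕ) (x : Fin n → ℝ) : ℝ :=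
  ∏ i, besselMonomial (γ i) (α i) (x i)

/-- The normalized mean over the sphere of radius `r` of an even monomial. -/
def radialCoeff {n : ℕ} (γ : Fin n → ℝ) (α : Fin n →₀ ℕ) (r : ℝ) : ℝ :=
  α.multinomial * besselMonomial (effDim γ - 1) (α.sum fun _ m => m) r

theorem continuous_besselMonomial (ν : ℝ) (k : ℕ) : Continuous (besselMonomial ν k) := by
  unfold besselMonomial; fun_prop

theorem continuous_besselProd {n : ℕ} (γ : Fin n → ℝ) (α : Fin n →₀ ℕ) :
    Continuous (besselProd γ α) :=
  continuous_finsetProd _ fun i _ => (continuous_besselMonomial _ _).comp (continuous_apply i)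

theorem finsupp_sum_eq_univ_sum {n : ℕ} (α : Fin n →₀ ℕ) : (α.sum fun _ m => m) = ∑ i, α i :=
  Finsupp.sum_fintype _ _ fun _ => rfl

/-- The integral factors over the coordinates. Expanding the product of one-dimensional convolutions
gives choices of a splitting of each `α i`, which are the splittings of the multi-index `α`. -/
theorem integral_besselProd_cube {n : ℕ} {γ : Fin n → ℝ} (hγ : ∀ i, 0 < γ i)
    (x y : Fin n → ℝ) (α : Fin n →₀ ℕ) :
    ∫ φ, besselProd γ α (translatedPoint x y φ) ∂(cubeMeasure γ)
      = ∑ q ∈ Finset.HasAntidiagonal.antidiagonal α, besselProd γ q.1 x * besselProd γ q.2 y := by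
  simp only [besselProd, translatedPoint_apply, cubeMeasure]
  rw [integral_fintype_prod_eq_prod
    (f := fun i φ => besselMonomial (γ i) (α i) (triangleSide (x i) (y i) φ))]
  simp only [integral_besselMonomial (hγ _)]
  rw [Finset.prod_univ_sum]
  refine Finset.sum_bij' (fun p _ => (Finsupp.equivFunOnFinite.symm fun i => (p i).1,
      Finsupp.equivFunOnFinite.symm fun i => (p i).2)) (fun q _ i => (q.1 i, q.2 i)) ?_ ?_ ?_ ?_ ?_
  · intro p hp
    rw [Finset.HasAntidiagonal.mem_antidiagonal]
    ext i
    have := Fintype.mem_piFinset.1 hp i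
    simpa using this
  · intro q hq
    rw [Finset.HasAntidiagonal.mem_antidiagonal] at hq
    rw [Fintype.mem_piFinset]
    intro i
    rw [Finset.HasAntidiagonal.mem_antidiagonal, ← hq]
    rfl
  · intro p _
    rfl
  · intro q _
    ext <;> rfl
  · intro p _
    simp [Finset.prod_mul_distrib]

theorem integral_uniformSphere {n : ℕ} (hn : 0 < n) {γ : Fin n → ℝ} (hγ : ∀ i, -1 < γ i)
    (g : UnitSphere n → ℝ) :
    ∫ y, g y ∂(uniformSphere γ)
      = 1 / sphereArea γ * ∫ y in posSphere n, g y * sphereWeight γ y ∂(surfaceMeasure n) := by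
  have h := sphereArea_pos hn hγ
  rw [uniformSphere, integral_smul_measure, ENNReal.toReal_ofReal (by positivity), smul_eq_mul,
    weightedSphere, integral_withDensity_ofReal (measurableSet_posSphere n)
      (measurable_sphereWeight γ)
      fun y hy => Finset.prod_pos fun i _ => Real.rpow_pos_of_pos (hy i) _]

/-- An even monomial times `y^γ` is the weight with exponents `γ + 2α`, so the mean is a ratio of
two weighted areas. The Gamma factors cancel against the Bessel coefficients, and the factorials
left over form the multinomial coefficient. -/
theorem integral_besselProd_sphere {n : ℕ} (hn : 0 < n) {γ : Fin n → ℝ} (hγ : ∀ i, 0 < γ i)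
    (α : Fin n →₀ ℕ) (r : ℝ) :
    ∫ y, besselProd γ α (scaled r y) ∂(uniformSphere γ) = radialCoeff γ α r := by
  have hγ1 : ∀ i, -1 < γ i := fun i => by linarith [hγ i]
  have hδ1 : ∀ i, -1 < γ i + 2 * α i := fun i => by
    have : (0 : ℝ) ≤ α i := by positivity
    linarith [hγ i]
  have h1 : ∀ y : UnitSphere n, y ∈ posSphere n → besselProd γ α (scaled r y) * sphereWeight γ y
      = (∏ i, besselCoeff (γ i) (α i)) * (r ^ 2) ^ (∑ i, α i) *
        sphereWeight (fun i => γ i + 2 * α i) y := by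
    intro y hy
    simp only [besselProd, besselMonomial, sphereWeight, scaled]
    rw [← Finset.prod_pow_eq_pow_sum, ← Finset.prod_mul_distrib, ← Finset.prod_mul_distrib,
      ← Finset.prod_mul_distrib]
    refine Finset.prod_congr rfl fun i _ => ?_
    rw [Real.rpow_add (hy i), Real.rpow_mul (hy i).le, Real.rpow_natCast, Real.rpow_two]
    ring
  rw [integral_uniformSphere hn hγ1, setIntegral_congr_fun (measurableSet_posSphere n)
    (fun y hy => h1 y hy), integral_const_mul]
  change 1 / sphereArea γ * (_ * sphereArea fun i => γ i + 2 * α i) = _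
  rw [sphereArea_eq hn hγ1, sphereArea_eq hn hδ1]
  have hd : effDim (fun i => γ i + 2 * α i) / 2 = (∑ i, α i : ℕ) + effDim γ / 2 := by
    simp only [effDim, Finset.sum_add_distrib, ← Finset.mul_sum]
    push_cast
    ring
  have hG : ∀ i, Real.Gamma ((γ i + 2 * α i + 1) / 2) = Real.Gamma (α i + (γ i + 1) / 2) :=
    fun i => by congr 1; ring
  have hGpos : ∀ i, 0 < Real.Gamma ((γ i + 1) / 2) := fun i =>
    Real.Gamma_pos_of_pos (by linarith [hγ i])
  have hGpos2 : ∀ i, 0 < Real.Gamma (α i + (γ i + 1) / 2) := fun i =>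
    Real.Gamma_pos_of_pos (by have := hγ i; positivity)
  have hD := effDim_pos hn hγ1
  have hDpos : 0 < Real.Gamma (effDim γ / 2) := Real.Gamma_pos_of_pos (by positivity)
  have hDpos2 : 0 < Real.Gamma ((∑ i, α i : ℕ) + effDim γ / 2) :=
    Real.Gamma_pos_of_pos (by positivity)
  have hmult : (∏ i, ((α i).factorial : ℝ)) * α.multinomial = (∑ i, α i).factorial := by
    rw [Finsupp.multinomial_eq_of_support_subset (Finset.subset_univ _)]
    exact_mod_cast Nat.multinomial_spec Finset.univ α
  have hfact : 0 < ∏ i, ((α i).factorial : ℝ) := Finset.prod_pos fun i _ => by positivity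
  have hprod : (∏ i, besselCoeff (γ i) (α i)) *
      (∏ i, (1 / 2 * Real.Gamma ((γ i + 2 * α i + 1) / 2)))
      = (∏ i, (1 / 2 * Real.Gamma ((γ i + 1) / 2))) /
        (4 ^ (∑ i, α i) * ∏ i, ((α i).factorial : ℝ)) := by
    rw [← Finset.prod_pow_eq_pow_sum, ← Finset.prod_mul_distrib, ← Finset.prod_mul_distrib,
      ← Finset.prod_div_distrib]
    refine Finset.prod_congr rfl fun i _ => ?_
    have := hGpos2 i
    rw [hG, besselCoeff]
    generalize Real.Gamma (α i + (γ i + 1) / 2) = G at this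
    field_simp
  have hP : 0 < ∏ i, (1 / 2 * Real.Gamma ((γ i + 1) / 2)) :=
    Finset.prod_pos fun i _ => by have := hGpos i; positivity
  rw [radialCoeff, besselMonomial, besselCoeff, finsupp_sum_eq_univ_sum, hd, sub_add_cancel]
  set P := ∏ i, (1 / 2 * Real.Gamma ((γ i + 1) / 2))
  set P' := ∏ i, (1 / 2 * Real.Gamma ((γ i + 2 * α i + 1) / 2))
  rw [← hmult]
  set Fc := ∏ i, ((α i).factorial : ℝ)
  set B := ∏ i, besselCoeff (γ i) (α i)
  have hm0 : (α.multinomial : ℝ) ≠ 0 := by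
    intro h0
    rw [h0, mul_zero] at hmult
    have : (0 : ℝ) < (∑ i, α i).factorial := by positivity
    linarith
  have e : P' * B = P / (4 ^ (∑ i, α i) * Fc) := by rw [mul_comm]; exact hprod
  calc _ = (P' * B) * ((r ^ 2) ^ (∑ i, α i) * Real.Gamma (effDim γ / 2)) /
        (P * Real.Gamma ((∑ i, α i : ℕ) + effDim γ / 2)) := by field_simp
    _ = _ := by rw [e]; field_simp

theorem translatedPoint_mem_Icc {n : ℕ} (x y φ : Fin n → ℝ) :
    translatedPoint x y φ ∈ Icc 0 fun i => |x i| + |y i| :=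
  ⟨fun _ => triangleSide_nonneg _ _ _, fun _ => triangleSide_le _ _ _⟩

theorem abs_scaled_le {n : ℕ} (r : ℝ) (y : UnitSphere n) (i : Fin n) : |scaled r y i| ≤ |r| := by
  have h : scaled r y i ^ 2 ≤ r ^ 2 := by
    rw [← sum_sq_scaled r y]
    exact Finset.single_le_sum (f := fun j => scaled r y j ^ 2) (fun j _ => sq_nonneg _)
      (Finset.mem_univ i)
  exact sq_le_sq.1 h

theorem meanPoint_mem_Icc {n : ℕ} (x : Fin n → ℝ) (r : ℝ) (p : UnitSphere n × (Fin n → ℝ)) :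
    translatedPoint x (scaled r p.1) p.2 ∈ Icc 0 fun i => |x i| + |r| :=
  ⟨(translatedPoint_mem_Icc _ _ _).1, fun i => ((translatedPoint_mem_Icc _ _ _).2 i).trans
    (by simpa using abs_scaled_le r p.1 i)⟩

theorem iteratedPoint_mem_Icc {n : ℕ} (x : Fin n → ℝ) (l m : ℝ)
    (p : (UnitSphere n × (Fin n → ℝ)) × (UnitSphere n × (Fin n → ℝ))) :
    iteratedPoint l m x p ∈ Icc 0 fun i => |x i| + |l| + |m| := by
  have h := meanPoint_mem_Icc x l p.1
  refine ⟨(translatedPoint_mem_Icc _ _ _).1, fun i => ((meanPoint_mem_Icc _ m p.2).2 i).trans ?_⟩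
  have h1 := h.2 i
  simp only [abs_of_nonneg (h.1 i)]
  linarith

theorem integral_besselProd_mean {n : ℕ} (hn : 0 < n) {γ : Fin n → ℝ} (hγ : ∀ i, 0 < γ i)
    (x : Fin n → ℝ) (r : ℝ) (α : Fin n →₀ ℕ) :
    ∫ p, besselProd γ α (translatedPoint x (scaled r p.1) p.2) ∂(meanMeasure γ)
      = ∑ q ∈ Finset.HasAntidiagonal.antidiagonal α, besselProd γ q.1 x * radialCoeff γ q.2 r := by
  have := isProbabilityMeasure_meanMeasure hn hγ
  have := isProbabilityMeasure_uniformSphere hn (γ := γ) fun i => by linarith [hγ i]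
  have hint : Integrable (fun p : UnitSphere n × (Fin n → ℝ) =>
      besselProd γ α (translatedPoint x (scaled r p.1) p.2)) (meanMeasure γ) :=
    integrable_comp_of_mem_compact (measurable_meanPoint_right x r) isCompact_Icc
      (ae_of_all _ (meanPoint_mem_Icc x r)) (continuous_besselProd γ α)
  rw [meanMeasure] at hint ⊢
  rw [integral_prod _ hint]
  simp only [integral_besselProd_cube hγ]
  rw [integral_finsetSum]
  · simp only [integral_const_mul, integral_besselProd_sphere hn hγ]
  · intro q _
    refine Integrable.const_mul ?_ _
    refine integrable_comp_of_mem_compact (T := fun y : UnitSphere n => scaled r y)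
      (K := Icc (fun _ => -|r|) fun _ => |r|)
      (measurable_scaled measurable_const measurable_id) isCompact_Icc (ae_of_all _ fun y => ?_)
      (continuous_besselProd γ _)
    exact ⟨fun i => (abs_le.1 (abs_scaled_le r y i)).1, fun i => (abs_le.1 (abs_scaled_le r y i)).2⟩

/-! ### The law of an iterated mean -/

theorem coeff_sum_X_pow_degree {n : ℕ} (α : Fin n →₀ ℕ) (k : ℕ) :
    MvPolynomial.coeff α ((∑ i, MvPolynomial.X i : MvPolynomial (Fin n) ℝ) ^ k)
      = if (α.sum fun _ m => m) = k then (α.multinomial : ℝ) else 0 := by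
  rw [MvPolynomial.coeff_sum_X_pow_of_fintype]
  split_ifs <;> simp

/-- Comparing coefficients in `(∑ Xᵢ)^(a+b) = (∑ Xᵢ)^a (∑ Xᵢ)^b` gives a Vandermonde identity for
multinomials. Through it the multi-index convolution of radial factors collapses to the
one-dimensional convolution that a translation of the radius produces. -/
theorem sum_radialCoeff_mul {n : ℕ} (γ : Fin n → ℝ) (l m : ℝ) (α : Fin n →₀ ℕ) :
    ∑ q ∈ Finset.HasAntidiagonal.antidiagonal α, radialCoeff γ q.1 l * radialCoeff γ q.2 m
      = α.multinomial * ∑ q ∈ Finset.HasAntidiagonal.antidiagonal (α.sum fun _ k => k),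
          besselMonomial (effDim γ - 1) q.1 l * besselMonomial (effDim γ - 1) q.2 m := by
  have h1 : ∀ q ∈ Finset.HasAntidiagonal.antidiagonal (α.sum fun _ k => k),
      (α.multinomial : ℝ) = ∑ p ∈ Finset.HasAntidiagonal.antidiagonal α,
        (if (p.1.sum fun _ k => k) = q.1 then (p.1.multinomial : ℝ) else 0) *
          (if (p.2.sum fun _ k => k) = q.2 then (p.2.multinomial : ℝ) else 0) := by
    intro q hq
    have h2 := coeff_sum_X_pow_degree α (α.sum fun _ k => k)
    rw [if_pos rfl, ← Finset.HasAntidiagonal.mem_antidiagonal.1 hq, pow_add,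
      MvPolynomial.coeff_mul] at h2
    rw [← h2]
    simp only [coeff_sum_X_pow_degree]
  have h3 : ∀ q ∈ Finset.HasAntidiagonal.antidiagonal (α.sum fun _ k => k),
      (α.multinomial : ℝ) * (besselMonomial (effDim γ - 1) q.1 l *
          besselMonomial (effDim γ - 1) q.2 m)
        = ∑ p ∈ Finset.HasAntidiagonal.antidiagonal α,
        (if (p.1.sum fun _ k => k) = q.1 then (p.1.multinomial : ℝ) else 0) *
          (if (p.2.sum fun _ k => k) = q.2 then (p.2.multinomial : ℝ) else 0) *
          (besselMonomial (effDim γ - 1) q.1 l * besselMonomial (effDim γ - 1) q.2 m) :=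
    fun q hq => by rw [h1 q hq, Finset.sum_mul]
  rw [Finset.mul_sum, Finset.sum_congr rfl h3, Finset.sum_comm]
  refine Finset.sum_congr rfl fun p hp => ?_
  have hd : (p.1.sum fun _ k => k) + (p.2.sum fun _ k => k) = α.sum fun _ k => k := by
    rw [← Finset.HasAntidiagonal.mem_antidiagonal.1 hp]
    simp only [finsupp_sum_eq_univ_sum, Finsupp.add_apply, Finset.sum_add_distrib]
  -- A splitting of `α` contributes only at the pair of its two total degrees.
  rw [Finset.sum_eq_single ((p.1.sum fun _ k => k), p.2.sum fun _ k => k)]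
  · simp only [if_true, radialCoeff]
    ring
  · rintro ⟨a, b⟩ _ hne
    by_cases ha : (p.1.sum fun _ k => k) = a
    · have hb : (p.2.sum fun _ k => k) ≠ b := fun hb => hne (by rw [ha, hb])
      simp [hb]
    · simp [ha]
  · intro hn
    exact absurd (Finset.HasAntidiagonal.mem_antidiagonal.2 hd) hn

/-- The point at which the function is evaluated in the translate of a spherical mean. -/
def translatedMeanPoint {n : ℕ} (l m : ℝ) (x : Fin n → ℝ)
    (q : ℝ × (UnitSphere n × (Fin n → ℝ))) : Fin n → ℝ :=
  translatedPoint x (scaled (triangleSide m l q.1) q.2.1) q.2.2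

theorem measurable_translatedMeanPoint {n : ℕ} (l m : ℝ) (x : Fin n → ℝ) :
    Measurable (translatedMeanPoint l m x) := by
  have := (continuous_triangleSide m l).measurable
  exact measurable_translatedPoint measurable_const
    (measurable_scaled (by fun_prop) (by fun_prop)) (by fun_prop)

theorem translatedMeanPoint_mem_Icc {n : ℕ} (l m : ℝ) (x : Fin n → ℝ)
    (q : ℝ × (UnitSphere n × (Fin n → ℝ))) :
    translatedMeanPoint l m x q ∈ Icc 0 fun i => |x i| + |l| + |m| := by
  have h := meanPoint_mem_Icc x (triangleSide m l q.1) q.2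
  refine ⟨h.1, fun i => (h.2 i).trans ?_⟩
  have := triangleSide_le m l q.1
  simp only [abs_of_nonneg (triangleSide_nonneg m l q.1)]
  linarith

theorem integral_besselProd_iterated {n : ℕ} (hn : 0 < n) {γ : Fin n → ℝ} (hγ : ∀ i, 0 < γ i)
    (x : Fin n → ℝ) (l m : ℝ) (α : Fin n →₀ ℕ) :
    ∫ p, besselProd γ α (iteratedPoint l m x p) ∂((meanMeasure γ).prod (meanMeasure γ))
      = ∑ q ∈ Finset.HasAntidiagonal.antidiagonal α, besselProd γ q.1 x *
          ∑ u ∈ Finset.HasAntidiagonal.antidiagonal q.2,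
            radialCoeff γ u.1 l * radialCoeff γ u.2 m := by
  have := isProbabilityMeasure_meanMeasure hn hγ
  rw [integral_prod _ (integrable_comp_of_mem_compact (measurable_iteratedPoint_right l m x)
    isCompact_Icc (ae_of_all _ (iteratedPoint_mem_Icc x l m)) (continuous_besselProd γ α))]
  simp only [iteratedPoint, integral_besselProd_mean hn hγ]
  rw [integral_finsetSum]
  · simp only [integral_mul_const, integral_besselProd_mean hn hγ]
    -- The two nested antidiagonal sums are the coefficients of `(W * H l) * H m` and `W * (H l * H
    -- m)`.
    let W : MvPowerSeries (Fin n) ℝ := fun α => besselProd γ α x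
    let H : ℝ → MvPowerSeries (Fin n) ℝ := fun r α => radialCoeff γ α r
    have hW : ∀ α, MvPowerSeries.coeff α W = besselProd γ α x := fun _ => rfl
    have hH : ∀ r α, MvPowerSeries.coeff α (H r) = radialCoeff γ α r := fun _ _ => rfl
    have e := congrArg (MvPowerSeries.coeff α) (mul_assoc W (H l) (H m))
    simpa only [MvPowerSeries.coeff_mul, hW, hH] using e
  · intro q _
    refine Integrable.mul_const ?_ _
    exact integrable_comp_of_mem_compact (measurable_meanPoint_right x l) isCompact_Icc
      (ae_of_all _ (meanPoint_mem_Icc x l)) (continuous_besselProd γ _)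

/-- The mean at the random radius is integrated first; its radial factor is a multiple of a
normalized power of order `n + |γ| - 1`, so the remaining integral over the angle is the
one-dimensional product formula. -/
theorem integral_besselProd_translated {n : ℕ} (hn : 0 < n) {γ : Fin n → ℝ}
    (hγ : ∀ i, 0 < γ i) (x : Fin n → ℝ) (l m : ℝ) (α : Fin n →₀ ℕ) :
    ∫ p, besselProd γ α (translatedMeanPoint l m x p)
        ∂((angleMeasure (effDim γ - 1)).prod (meanMeasure γ))
      = ∑ q ∈ Finset.HasAntidiagonal.antidiagonal α, besselProd γ q.1 x *
          ∑ u ∈ Finset.HasAntidiagonal.antidiagonal q.2,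
            radialCoeff γ u.1 m * radialCoeff γ u.2 l := by
  have hd : 0 < effDim γ - 1 := by linarith [one_lt_effDim hn hγ]
  have := isProbabilityMeasure_meanMeasure hn hγ
  have := isProbabilityMeasure_angleMeasure hd
  rw [integral_prod _ (integrable_comp_of_mem_compact (measurable_translatedMeanPoint l m x)
    isCompact_Icc (ae_of_all _ (translatedMeanPoint_mem_Icc l m x)) (continuous_besselProd γ α))]
  simp only [translatedMeanPoint, integral_besselProd_mean hn hγ]
  rw [integral_finsetSum]
  · simp only [integral_const_mul, radialCoeff, integral_besselMonomial hd]
    refine Finset.sum_congr rfl fun q _ => ?_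
    rw [← sum_radialCoeff_mul]
    rfl
  · intro q _
    refine Integrable.const_mul ?_ _
    refine integrable_angleMeasure_of_continuous hd ?_
    have h1 := (continuous_besselMonomial (effDim γ - 1) (q.2.sum fun _ k => k)).comp
      (continuous_triangleSide m l)
    exact h1.const_mul _

theorem map_iteratedPoint_eq {n : ℕ} (hn : 0 < n) {γ : Fin n → ℝ} (hγ : ∀ i, 0 < γ i)
    (x : Fin n → ℝ) (l m : ℝ) :
    ((meanMeasure γ).prod (meanMeasure γ)).map (iteratedPoint l m x)
      = ((angleMeasure (effDim γ - 1)).prod (meanMeasure γ)).map (translatedMeanPoint l m x) := by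
  have hd : 0 < effDim γ - 1 := by linarith [one_lt_effDim hn hγ]
  have := isProbabilityMeasure_meanMeasure hn hγ
  have := isProbabilityMeasure_angleMeasure hd
  have h1 := measurable_iteratedPoint_right l m x
  have h2 := measurable_translatedMeanPoint l m x
  refine measure_eq_of_even_moments (R := fun i => |x i| + |l| + |m|) ?_ ?_ fun α => ?_
  · exact (ae_map_iff h1.aemeasurable (measurableSet_Icc (a := 0)
      (b := fun i => |x i| + |l| + |m|))).2 (ae_of_all _ (iteratedPoint_mem_Icc x l m))
  · exact (ae_map_iff h2.aemeasurable (measurableSet_Icc (a := 0)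
      (b := fun i => |x i| + |l| + |m|))).2 (ae_of_all _ (translatedMeanPoint_mem_Icc l m x))
  -- The nonzero Bessel coefficients turn raw moments into normalized ones; what then differs is the
  -- order of `l` and `m`, settled by commutativity of power series.
  · have hc : (∏ i, besselCoeff (γ i) (α i)) ≠ 0 :=
      (Finset.prod_pos fun i _ => besselCoeff_pos (hγ i) _).ne'
    have hB : ∀ z : Fin n → ℝ, (∏ i, besselCoeff (γ i) (α i)) * ∏ i, (z i ^ 2) ^ α i
        = besselProd γ α z := fun z => by
      simp only [besselProd, besselMonomial, Finset.prod_mul_distrib]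
    have hcont := continuous_besselProd γ α
    refine mul_left_cancel₀ hc ?_
    rw [← integral_const_mul, ← integral_const_mul]
    simp only [hB]
    rw [integral_map h1.aemeasurable hcont.aestronglyMeasurable,
      integral_map h2.aemeasurable hcont.aestronglyMeasurable,
      integral_besselProd_iterated hn hγ, integral_besselProd_translated hn hγ]
    refine Finset.sum_congr rfl fun q _ => ?_
    congr 1
    let H : ℝ → MvPowerSeries (Fin n) ℝ := fun r α => radialCoeff γ α r
    have hH : ∀ r α, MvPowerSeries.coeff α (H r) = radialCoeff γ α r := fun _ _ => rfl
    have e := congrArg (MvPowerSeries.coeff q.2) (mul_comm (H l) (H m))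
    simpa only [MvPowerSeries.coeff_mul, hH] using e

theorem map_iteratedPoint_comm {n : ℕ} (hn : 0 < n) {γ : Fin n → ℝ} (hγ : ∀ i, 0 < γ i)
    (x : Fin n → ℝ) (l m : ℝ) :
    ((meanMeasure γ).prod (meanMeasure γ)).map (iteratedPoint l m x)
      = ((meanMeasure γ).prod (meanMeasure γ)).map (iteratedPoint m l x) := by
  have : translatedMeanPoint l m x = translatedMeanPoint m l x := by
    funext q
    simp only [translatedMeanPoint, triangleSide_comm m l]
  rw [map_iteratedPoint_eq hn hγ, map_iteratedPoint_eq hn hγ, this]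

/-- Convergence is integrability of `f` against the law of the iterated point, which is symmetric in
the radii because the third side of the triangle is. -/
theorem iteratedMeanConverges_comm {n : ℕ} (hn : 0 < n) {γ : Fin n → ℝ} (hγ : ∀ i, 0 < γ i)
    {f : (Fin n → ℝ) → ℝ} (hf : AEStronglyMeasurable f (volume.restrict (posOrthant n)))
    {x : Fin n → ℝ} (hx : x ∈ posOrthant n) {l m : ℝ} (hl : 0 < l) (hm : 0 < m) :
    IteratedMeanConverges γ l m f x ↔ IteratedMeanConverges γ m l f x := by
  have h1 : ∀ {l m : ℝ}, 0 < l → 0 < m → (IteratedMeanConverges γ l m f x ↔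
      Integrable f (((meanMeasure γ).prod (meanMeasure γ)).map (iteratedPoint l m x))) := by
    intro l m hl hm
    have hq := quasiMeasurePreserving_iteratedPoint hγ hx hl hm
    rw [iteratedMeanConverges_iff hn hγ,
      integrable_map_measure (hf.mono_ac hq.absolutelyContinuous) hq.aemeasurable]
    rfl
  rw [h1 hl hm, h1 hm hl, map_iteratedPoint_comm hn hγ]

/-! ### Iterated integrals as integrals over the product -/

/-- Translations in the later coordinates carry coordinate `0` along as a parameter; this is what
makes induction on the dimension possible. -/
theorem foldr_coordTranslation_succ {n : ℕ} (γ y : Fin (n + 1) → ℝ)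
    (f : (Fin (n + 1) → ℝ) → ℝ) (L : List (Fin n)) (x : Fin (n + 1) → ℝ) :
    L.foldr (fun i g => coordTranslation i.succ (γ i.succ) (y i.succ) g) f x
      = L.foldr (fun i g => coordTranslation i (Fin.tail γ i) (Fin.tail y i) g)
          (fun z => f (Fin.cons (x 0) z)) (Fin.tail x) := by
  induction L generalizing x with
  | nil => simp
  | cons i L ih =>
    simp only [List.foldr_cons, coordTranslation]
    simp only [ih, Fin.tail_update_succ, Function.update_of_ne (Fin.succ_ne_zero i).symm]
    rfl

theorem multiTranslation_succ {n : ℕ} (γ y : Fin (n + 1) → ℝ) (f : (Fin (n + 1) → ℝ) → ℝ)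
    (x : Fin (n + 1) → ℝ) :
    multiTranslation γ y f x
      = genTranslation (γ 0) (y 0) (fun s => multiTranslation (Fin.tail γ) (Fin.tail y)
          (fun z => f (Fin.cons s z)) (Fin.tail x)) (x 0) := by
  unfold multiTranslation
  rw [List.finRange_succ, List.foldr_cons, List.foldr_map, coordTranslation]
  congr 1
  funext s
  rw [foldr_coordTranslation_succ, Function.update_self, Fin.tail_update_zero]

theorem translatedPoint_cons {n : ℕ} (x y : Fin (n + 1) → ℝ) (φ₀ : ℝ) (φ : Fin n → ℝ) :
    translatedPoint x y (Fin.cons φ₀ φ)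
      = Fin.cons (triangleSide (x 0) (y 0) φ₀) (translatedPoint (Fin.tail x) (Fin.tail y) φ) := by
  funext i
  refine Fin.cases rfl (fun j => rfl) i

theorem measurePreserving_cons_cubeMeasure {n : ℕ} (γ : Fin (n + 1) → ℝ) :
    MeasurePreserving (MeasurableEquiv.piFinSuccAbove (fun _ => ℝ) (0 : Fin (n + 1))).symm
      ((angleMeasure (γ 0)).prod (cubeMeasure (Fin.tail γ))) (cubeMeasure γ) :=
  (measurePreserving_piFinSuccAbove (fun i => angleMeasure (γ i)) 0).symm

theorem piFinSuccAbove_symm_eq_cons {n : ℕ} (q : ℝ × (Fin n → ℝ)) :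
    (MeasurableEquiv.piFinSuccAbove (fun _ => ℝ) (0 : Fin (n + 1))).symm q
      = (Fin.cons q.1 q.2 : Fin (n + 1) → ℝ) := by
  simp [MeasurableEquiv.piFinSuccAbove_symm_apply, Fin.insertNthEquiv]

/-- Fubini, one coordinate at a time. Integrability on the product is needed only once: it passes to
almost every slice, where the induction hypothesis applies. -/
theorem multiTranslation_eq_integral {n : ℕ} {γ : Fin n → ℝ} (hγ : ∀ i, 0 < γ i)
    (x y : Fin n → ℝ) (f : (Fin n → ℝ) → ℝ)
    (hf : Integrable (fun φ => f (translatedPoint x y φ)) (cubeMeasure γ)) :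
    multiTranslation γ y f x = ∫ φ, f (translatedPoint x y φ) ∂(cubeMeasure γ) := by
  induction n with
  | zero =>
    have := isProbabilityMeasure_cubeMeasure hγ
    have h : ∀ φ, translatedPoint x y φ = x := fun φ => Subsingleton.elim _ _
    simp only [h]
    simp [multiTranslation]
  | succ n ih =>
    have hp := measurePreserving_cons_cubeMeasure γ
    have hf2 := (hp.integrable_comp_emb (MeasurableEquiv.measurableEmbedding _)).2 hf
    have he : ∀ q : ℝ × (Fin n → ℝ),
        f (translatedPoint x y ((MeasurableEquiv.piFinSuccAbove (fun _ => ℝ)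
          (0 : Fin (n + 1))).symm q))
        = f (Fin.cons (triangleSide (x 0) (y 0) q.1)
            (translatedPoint (Fin.tail x) (Fin.tail y) q.2)) := fun q => by
      rw [piFinSuccAbove_symm_eq_cons, translatedPoint_cons]
    simp only [Function.comp_def, he] at hf2
    rw [← hp.integral_comp (MeasurableEquiv.measurableEmbedding _)]
    simp only [he]
    rw [integral_prod _ hf2, multiTranslation_succ, genTranslation_eq (hγ 0)]
    refine integral_congr_ae ?_
    filter_upwards [hf2.prod_right_ae] with φ₀ hφ₀
    exact ih (γ := Fin.tail γ) (fun i => hγ i.succ) (Fin.tail x) (Fin.tail y)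
      (fun z => f (Fin.cons (triangleSide (x 0) (y 0) φ₀) z)) hφ₀

theorem sphericalMean_eq_integral {n : ℕ} (hn : 0 < n) {γ : Fin n → ℝ} (hγ : ∀ i, 0 < γ i)
    {x : Fin n → ℝ} {r : ℝ} {f : (Fin n → ℝ) → ℝ}
    (hf : Integrable (fun p : UnitSphere n × (Fin n → ℝ) =>
      f (translatedPoint x (scaled r p.1) p.2)) (meanMeasure γ)) :
    sphericalMean γ r f x
      = ∫ p, f (translatedPoint x (scaled r p.1) p.2) ∂(meanMeasure γ) := by
  rw [sphericalMean, ← integral_uniformSphere hn fun i => by linarith [hγ i]]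
  rw [meanMeasure] at hf ⊢
  rw [integral_prod _ hf]
  refine integral_congr_ae ?_
  filter_upwards [hf.prod_right_ae] with y hy
  exact multiTranslation_eq_integral hγ x (scaled r y) f hy

theorem iteratedMean_eq_integral {n : ℕ} (hn : 0 < n) {γ : Fin n → ℝ} (hγ : ∀ i, 0 < γ i)
    {x : Fin n → ℝ} {l m : ℝ} {f : (Fin n → ℝ) → ℝ}
    (hf : Integrable (fun p => f (iteratedPoint l m x p)) ((meanMeasure γ).prod (meanMeasure γ))) :
    iteratedMean γ l m f x
      = ∫ p, f (iteratedPoint l m x p) ∂((meanMeasure γ).prod (meanMeasure γ)) := by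
  have h1 : ∀ᵐ p ∂(meanMeasure γ), sphericalMean γ m f (translatedPoint x (scaled l p.1) p.2)
      = ∫ q, f (iteratedPoint l m x (p, q)) ∂(meanMeasure γ) := by
    filter_upwards [hf.prod_right_ae] with p hp
    exact sphericalMean_eq_integral hn hγ hp
  rw [iteratedMean, sphericalMean_eq_integral hn hγ
    ((integrable_congr h1).2 hf.integral_prod_left), integral_prod _ hf]
  exact integral_congr_ae h1

/-! ### The iterated mean as a generalized translation -/

theorem integrable_translatedMeanPoint {n : ℕ} (hn : 0 < n) {γ : Fin n → ℝ}
    (hγ : ∀ i, 0 < γ i) {f : (Fin n → ℝ) → ℝ}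
    (hf : AEStronglyMeasurable f (volume.restrict (posOrthant n))) {x : Fin n → ℝ}
    (hx : x ∈ posOrthant n) {l m : ℝ} (hl : 0 < l) (hm : 0 < m)
    (h : IteratedMeanConverges γ l m f x) :
    Integrable (fun q => f (translatedMeanPoint l m x q))
        ((angleMeasure (effDim γ - 1)).prod (meanMeasure γ)) ∧
      iteratedMean γ l m f x = ∫ q, f (translatedMeanPoint l m x q)
        ∂((angleMeasure (effDim γ - 1)).prod (meanMeasure γ)) := by
  rw [iteratedMeanConverges_iff hn hγ] at h
  have hq := quasiMeasurePreserving_iteratedPoint hγ hx hl hm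
  have hfP := hf.mono_ac hq.absolutelyContinuous
  have hT := measurable_translatedMeanPoint l m x
  have h1 := (integrable_map_measure hfP hq.aemeasurable).2 h
  rw [iteratedMean_eq_integral hn hγ h, ← integral_map hq.aemeasurable hfP]
  -- Measurability and integrability of `f` are known for the law of the iterated point; equality of
  -- the laws carries them to the other parametrization, with no separate null-set argument.
  rw [map_iteratedPoint_eq hn hγ] at hfP h1 ⊢
  exact ⟨(integrable_map_measure hfP hT.aemeasurable).1 h1, integral_map hT.aemeasurable hfP⟩

theorem iteratedMean_eq_integral_angle {n : ℕ} (hn : 0 < n) {γ : Fin n → ℝ}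
    (hγ : ∀ i, 0 < γ i) {f : (Fin n → ℝ) → ℝ}
    (hf : AEStronglyMeasurable f (volume.restrict (posOrthant n))) {x : Fin n → ℝ}
    (hx : x ∈ posOrthant n) {l m : ℝ} (hl : 0 < l) (hm : 0 < m)
    (h : IteratedMeanConverges γ l m f x) :
    Integrable (fun θ => sphericalMean γ (triangleSide m l θ) f x)
        (angleMeasure (effDim γ - 1)) ∧
      iteratedMean γ l m f x
        = ∫ θ, sphericalMean γ (triangleSide m l θ) f x ∂(angleMeasure (effDim γ - 1)) := by
  obtain ⟨h1, h2⟩ := integrable_translatedMeanPoint hn hγ hf hx hl hm h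
  have h3 : ∀ᵐ θ ∂(angleMeasure (effDim γ - 1)), sphericalMean γ (triangleSide m l θ) f x
      = ∫ p, f (translatedMeanPoint l m x (θ, p)) ∂(meanMeasure γ) := by
    filter_upwards [h1.prod_right_ae] with θ hθ
    exact sphericalMean_eq_integral hn hγ hθ
  refine ⟨(integrable_congr h3).2 h1.integral_prod_left, ?_⟩
  rw [h2, integral_prod _ h1]
  exact (integral_congr_ae h3).symm

/-! ### The single integral formula -/

/-- Heron's formula: both sides equal sixteen times the squared area of the triangle. -/
theorem kernel_base_triangleSide (l m θ : ℝ) :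
    (l ^ 2 - (triangleSide m l θ - m) ^ 2) * ((triangleSide m l θ + m) ^ 2 - l ^ 2)
      = (2 * l * m * Real.sin θ) ^ 2 := by
  have h := triangleSide_sq m l θ
  have hs := Real.sin_sq θ
  set r := triangleSide m l θ
  have e : (l ^ 2 - (r - m) ^ 2) * ((r + m) ^ 2 - l ^ 2)
      = 4 * m ^ 2 * r ^ 2 - (r ^ 2 + m ^ 2 - l ^ 2) ^ 2 := by ring
  rw [e, h, mul_pow, hs]
  ring

/-- The derivative contributes `m l sin θ / r`; its denominator cancels the factor `r` of the
integrand, and its sine raises the exponent from `n + |γ| - 3` to `n + |γ| - 2`. -/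
theorem abs_deriv_mul_kernelIntegrand {n : ℕ} (γ : Fin n → ℝ) {l m : ℝ} (hl : 0 < l)
    (hm : 0 < m) (f : (Fin n → ℝ) → ℝ) (x : Fin n → ℝ) {θ : ℝ} (hθ : θ ∈ Ioo 0 Real.pi) :
    |m * l * Real.sin θ / triangleSide m l θ| • kernelIntegrand γ l m f x (triangleSide m l θ)
      = (2 * l * m) ^ (effDim γ - 2) / 2 *
        (sphericalMean γ (triangleSide m l θ) f x * Real.sin θ ^ (effDim γ - 1 - 1)) := by
  have hs := Real.sin_pos_of_pos_of_lt_pi hθ.1 hθ.2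
  have hr := triangleSide_pos hm hl hθ
  have h1 : ((2 * l * m * Real.sin θ) ^ 2) ^ ((effDim γ - 3) / 2)
      = (2 * l * m * Real.sin θ) ^ (effDim γ - 2) / (2 * l * m * Real.sin θ) := by
    rw [← Real.rpow_two, ← Real.rpow_mul (by positivity), ← Real.rpow_sub_one (by positivity)]
    congr 1
    ring
  rw [kernelIntegrand, kernel_base_triangleSide, h1, Real.mul_rpow (by positivity) hs.le,
    abs_of_pos (by positivity), smul_eq_mul, show effDim γ - 1 - 1 = effDim γ - 2 by ring]
  field_simp

theorem kernelIntegrand_formula {n : ℕ} (hn : 0 < n) {γ : Fin n → ℝ} (hγ : ∀ i, 0 < γ i)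
    {f : (Fin n → ℝ) → ℝ} {x : Fin n → ℝ} {l m : ℝ} (hl : 0 < l) (hm : 0 < m)
    (h : Integrable (fun θ => sphericalMean γ (triangleSide m l θ) f x)
      (angleMeasure (effDim γ - 1))) :
    IntervalIntegrable (kernelIntegrand γ l m f x) volume |l - m| (l + m) ∧
      ∫ θ, sphericalMean γ (triangleSide m l θ) f x ∂(angleMeasure (effDim γ - 1))
        = 2 * Real.Gamma (effDim γ / 2) / (√Real.pi * Real.Gamma ((effDim γ - 1) / 2)) *
            (1 / (2 * l * m) ^ (effDim γ - 2)) *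
            ∫ r in |l - m|..(l + m), kernelIntegrand γ l m f x r := by
  have hd : 0 < effDim γ - 1 := by linarith [one_lt_effDim hn hγ]
  have him : triangleSide m l '' Ioo 0 Real.pi = Ioo |l - m| (l + m) := by
    rw [image_triangleSide hm hl, abs_sub_comm, add_comm]
  have hle : |l - m| ≤ l + m := abs_le.2 ⟨by linarith, by linarith⟩
  have hder : ∀ θ ∈ Ioo 0 Real.pi, HasDerivWithinAt (triangleSide m l)
      (m * l * Real.sin θ / triangleSide m l θ) (Ioo 0 Real.pi) θ := fun θ hθ =>
    (hasDerivAt_triangleSide hm hl hθ).hasDerivWithinAt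
  have hi := (integrable_angleMeasure_iff hd _).1 h
  rw [intervalIntegrable_iff_integrableOn_Ioo_of_le Real.pi_pos.le] at hi
  rw [intervalIntegrable_iff_integrableOn_Ioo_of_le hle, ← him,
    integrableOn_image_iff_integrableOn_abs_deriv_smul measurableSet_Ioo hder
      (injOn_triangleSide hm hl),
    integrableOn_congr_fun (fun θ hθ => abs_deriv_mul_kernelIntegrand γ hl hm f x hθ)
      measurableSet_Ioo]
  refine ⟨hi.const_mul _, ?_⟩
  rw [intervalIntegral.integral_of_le hle, integral_Ioc_eq_integral_Ioo, ← him,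
    integral_image_eq_integral_abs_deriv_smul measurableSet_Ioo hder (injOn_triangleSide hm hl),
    setIntegral_congr_fun measurableSet_Ioo
      (fun θ hθ => abs_deriv_mul_kernelIntegrand γ hl hm f x hθ),
    integral_const_mul, integral_angleMeasure hd,
    intervalIntegral.integral_of_le Real.pi_pos.le, integral_Ioc_eq_integral_Ioo, angleConst,
    sub_add_cancel]
  have hp : 0 < (2 * l * m) ^ (effDim γ - 2) := by positivity
  generalize (2 * l * m) ^ (effDim γ - 2) = c at hp
  field_simp

/-! ### Parity -/

/-- The substitution `φ ↦ π - φ` changes the sign of the cosine and keeps the sine. -/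
theorem genTranslation_neg (ν t : ℝ) (g : ℝ → ℝ) (s : ℝ) :
    genTranslation ν (-t) g s = genTranslation ν t g s := by
  unfold genTranslation
  congr 1
  have h := intervalIntegral.integral_comp_sub_left (a := 0) (b := Real.pi)
    (fun φ => g √(s ^ 2 + t ^ 2 - 2 * s * t * Real.cos φ) * Real.sin φ ^ (ν - 1)) Real.pi
  rw [sub_self, sub_zero] at h
  rw [← h]
  refine intervalIntegral.integral_congr fun φ _ => ?_
  simp only [Real.cos_pi_sub, Real.sin_pi_sub]
  congr 3
  ring

theorem multiTranslation_neg {n : ℕ} (γ y : Fin n → ℝ) (f : (Fin n → ℝ) → ℝ) :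
    multiTranslation γ (-y) f = multiTranslation γ y f := by
  unfold multiTranslation
  congr 1
  funext i g x
  simp only [coordTranslation, Pi.neg_apply, genTranslation_neg]

theorem sphericalMean_neg {n : ℕ} (γ : Fin n → ℝ) (r : ℝ) (f : (Fin n → ℝ) → ℝ)
    (x : Fin n → ℝ) : sphericalMean γ (-r) f x = sphericalMean γ r f x := by
  have h : ∀ y : UnitSphere n, scaled (-r) y = -scaled r y := fun y => by
    funext i; simp [scaled]
  simp only [sphericalMean, h, multiTranslation_neg]

theorem kernelIntegrand_neg {n : ℕ} (γ : Fin n → ℝ) (l m : ℝ) (f : (Fin n → ℝ) → ℝ)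
    (x : Fin n → ℝ) (r : ℝ) : kernelIntegrand γ l m f x (-r) = -kernelIntegrand γ l m f x r := by
  have h : (l ^ 2 - (-r - m) ^ 2) * ((-r + m) ^ 2 - l ^ 2)
      = (l ^ 2 - (r - m) ^ 2) * ((r + m) ^ 2 - l ^ 2) := by ring
  rw [kernelIntegrand, kernelIntegrand, sphericalMean_neg, h, mul_neg]

theorem symmKernelIntegrand_eq {n : ℕ} (γ : Fin n → ℝ) (a b : ℝ) (f : (Fin n → ℝ) → ℝ)
    (x : Fin n → ℝ) : symmKernelIntegrand γ a b f x
      = kernelIntegrand γ ((b - a) / 2) ((b + a) / 2) f x := by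
  funext r
  rw [symmKernelIntegrand, kernelIntegrand]
  congr 3
  ring

/-- For negative `c` the extra piece is the symmetric interval `[c, -c]`, over which an odd function
integrates to zero. -/
theorem integral_abs_eq_of_odd {g : ℝ → ℝ} (hg : ∀ r, g (-r) = -g r) {c d : ℝ} (hcd : |c| ≤ d)
    (h : IntervalIntegrable g volume c d) : ∫ r in |c|..d, g r = ∫ r in c..d, g r := by
  rcases le_total 0 c with hc | hc
  · rw [abs_of_nonneg hc]
  · rw [abs_of_nonpos hc] at hcd ⊢
    have h0 : ∫ r in c..-c, g r = 0 := by
      have h1 := intervalIntegral.integral_comp_neg (a := c) (b := -c) g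
      simp only [hg, intervalIntegral.integral_neg, neg_neg] at h1
      linarith
    have hmem : -c ∈ Icc c d := ⟨by linarith, hcd⟩
    have hcd' : c ≤ d := by linarith
    rw [← intervalIntegral.integral_add_adjacent_intervals (a := c) (b := -c) (c := d)
      (h.mono_set (by rw [uIcc_of_le hmem.1, uIcc_of_le hcd']; exact Icc_subset_Icc le_rfl hcd))
      (h.mono_set (by rw [uIcc_of_le hcd, uIcc_of_le hcd']; exact Icc_subset_Icc hmem.1 le_rfl)),
      h0, zero_add]

/-! ### Locally bounded functions -/

theorem exists_bound_on_Icc {n : ℕ} {f : (Fin n → ℝ) → ℝ}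
    (hb : ∀ R : ℝ, ∃ C : ℝ, ∀ z ∈ posOrthant n, ‖z‖ ≤ R → |f z| ≤ C) (B : Fin n → ℝ) :
    ∃ C : ℝ, ∀ z ∈ posOrthant n, z ∈ Icc 0 B → |f z| ≤ C := by
  obtain ⟨C, hC⟩ := hb ‖B‖
  refine ⟨C, fun z hz hzB => hC z hz ?_⟩
  refine (pi_norm_le_iff_of_nonneg (norm_nonneg _)).2 fun i => ?_
  rw [Real.norm_of_nonneg (hz i).le]
  exact (hzB.2 i).trans ((le_abs_self _).trans (norm_le_pi_norm B i))

theorem iteratedMeanConverges_of_bounded {n : ℕ} (hn : 0 < n) {γ : Fin n → ℝ}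
    (hγ : ∀ i, 0 < γ i) {f : (Fin n → ℝ) → ℝ}
    (hf : AEStronglyMeasurable f (volume.restrict (posOrthant n)))
    (hb : ∀ R : ℝ, ∃ C : ℝ, ∀ z ∈ posOrthant n, ‖z‖ ≤ R → |f z| ≤ C) {x : Fin n → ℝ}
    (hx : x ∈ posOrthant n) {l m : ℝ} (hl : 0 < l) (hm : 0 < m) :
    IteratedMeanConverges γ l m f x := by
  have := isProbabilityMeasure_meanMeasure hn hγ
  have hq := quasiMeasurePreserving_iteratedPoint hγ hx hl hm
  obtain ⟨C, hC⟩ := exists_bound_on_Icc hb fun i => |x i| + |l| + |m|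
  rw [iteratedMeanConverges_iff hn hγ]
  refine Integrable.of_bound (hf.comp_quasiMeasurePreserving hq) C ?_
  filter_upwards [hq.ae (ae_restrict_mem (measurableSet_posOrthant n))] with p hp
  exact hC _ hp (iteratedPoint_mem_Icc x l m p)

theorem integrable_mean_of_bounded {n : ℕ} (hn : 0 < n) {γ : Fin n → ℝ}
    (hγ : ∀ i, 0 < γ i) {f : (Fin n → ℝ) → ℝ}
    (hf : AEStronglyMeasurable f (volume.restrict (posOrthant n))) {x : Fin n → ℝ}
    (hx : x ∈ posOrthant n) {R C : ℝ}
    (hC : ∀ z ∈ posOrthant n, (z ∈ Icc 0 fun i => |x i| + R) → |f z| ≤ C) {r : ℝ} (hr : 0 < r)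
    (hrR : r ≤ R) :
    Integrable (fun p : UnitSphere n × (Fin n → ℝ) =>
      f (translatedPoint x (scaled r p.1) p.2)) (meanMeasure γ) ∧ |sphericalMean γ r f x| ≤ C := by
  have := isProbabilityMeasure_meanMeasure hn hγ
  have hq := quasiMeasurePreserving_meanPoint hγ hx hr
  have hae : ∀ᵐ p ∂(meanMeasure γ), ‖f (translatedPoint x (scaled r p.1) p.2)‖ ≤ C := by
    filter_upwards [hq.ae (ae_restrict_mem (measurableSet_posOrthant n))] with p hp
    have h := meanPoint_mem_Icc x r p
    refine hC _ hp ⟨h.1, fun i => (h.2 i).trans ?_⟩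
    rw [abs_of_pos hr]
    exact add_le_add le_rfl hrR
  have hi := Integrable.of_bound (hf.comp_quasiMeasurePreserving hq) C hae
  refine ⟨hi, ?_⟩
  rw [sphericalMean_eq_integral hn hγ hi]
  simpa using norm_integral_le_of_norm_le_const hae

theorem aestronglyMeasurable_sphericalMean {n : ℕ} (hn : 0 < n) {γ : Fin n → ℝ}
    (hγ : ∀ i, 0 < γ i) {f : (Fin n → ℝ) → ℝ}
    (hf : AEStronglyMeasurable f (volume.restrict (posOrthant n))) {x : Fin n → ℝ}
    (hx : x ∈ posOrthant n) {R C : ℝ}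
    (hC : ∀ z ∈ posOrthant n, (z ∈ Icc 0 fun i => |x i| + R) → |f z| ≤ C) :
    AEStronglyMeasurable (fun r => sphericalMean γ r f x) (volume.restrict (Ioo 0 R)) := by
  have hg := hf.stronglyMeasurable_mk
  have hfg := hf.ae_eq_mk
  set g := hf.mk f
  have hm : Measurable fun q : ℝ × (UnitSphere n × (Fin n → ℝ)) =>
      translatedPoint x (scaled q.1 q.2.1) q.2.2 :=
    measurable_translatedPoint measurable_const
      (measurable_scaled (by fun_prop) (by fun_prop)) (by fun_prop)
  have h1 : StronglyMeasurable fun r : ℝ => ∫ p : UnitSphere n × (Fin n → ℝ),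
      g (translatedPoint x (scaled r p.1) p.2) ∂(meanMeasure γ) :=
    (hg.comp_measurable hm).integral_prod_right'
  refine h1.aestronglyMeasurable.congr ?_
  filter_upwards [ae_restrict_mem measurableSet_Ioo] with r hr
  rw [sphericalMean_eq_integral hn hγ
    (integrable_mean_of_bounded hn hγ hf hx hC hr.1 hr.2.le).1]
  exact integral_congr_ae ((quasiMeasurePreserving_meanPoint hγ hx hr.1).ae_eq hfg).symm

/-- Below `m - l` no triangle exists and the kernel has a negative base, so the change of variables
says nothing. The mean is bounded there, and the kernel is singular at most at `r = m - l`, with an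
integrable power. -/
theorem intervalIntegrable_kernelIntegrand_inner {n : ℕ} (hn : 0 < n) {γ : Fin n → ℝ}
    (hγ : ∀ i, 0 < γ i) {f : (Fin n → ℝ) → ℝ}
    (hf : AEStronglyMeasurable f (volume.restrict (posOrthant n)))
    (hb : ∀ R : ℝ, ∃ C : ℝ, ∀ z ∈ posOrthant n, ‖z‖ ≤ R → |f z| ≤ C) {x : Fin n → ℝ}
    (hx : x ∈ posOrthant n) {l m : ℝ} (hl : 0 < l) (hlm : l < m) :
    IntervalIntegrable (kernelIntegrand γ l m f x) volume 0 (m - l) := by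
  obtain ⟨C, hC⟩ := exists_bound_on_Icc hb fun i => |x i| + (m - l)
  have hd : 0 < m - l := by linarith
  set s := (effDim γ - 3) / 2 with hs
  -- Integrability at the endpoint is exactly the condition `n + |γ| > 1`.
  have hs1 : -1 < s := by have := one_lt_effDim hn hγ; rw [hs]; linarith
  have h1 : IntervalIntegrable (fun r => (m - l - r) ^ s) volume 0 (m - l) := by
    have := (intervalIntegral.intervalIntegrable_rpow' (a := m - l) (b := 0) hs1).comp_sub_left
      (m - l)
    simpa using this
  have h2 : IntervalIntegrable (fun r => (m - l - r) ^ s *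
      ((m - l + r) ^ s * ((l + m) ^ 2 - r ^ 2) ^ s * r)) volume 0 (m - l) := by
    refine h1.mul_continuousOn ?_
    rw [uIcc_of_le hd.le]
    refine ContinuousOn.mul (ContinuousOn.mul
      (ContinuousOn.rpow_const (by fun_prop) fun r hr => Or.inl ?_)
      (ContinuousOn.rpow_const (by fun_prop) fun r hr => Or.inl ?_)) continuousOn_id
    · linarith [hr.1]
    · nlinarith [hr.1, hr.2]
  rw [intervalIntegrable_iff_integrableOn_Ioo_of_le hd.le] at h2 ⊢
  refine Integrable.mono (h2.mul_const C) ?_ ?_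
  · have hM := aestronglyMeasurable_sphericalMean hn hγ hf hx hC
    have hk : Measurable fun r : ℝ =>
        ((l ^ 2 - (r - m) ^ 2) * ((r + m) ^ 2 - l ^ 2)) ^ s := by fun_prop
    exact (hk.aestronglyMeasurable.mul hM).mul measurable_id.aestronglyMeasurable
  · filter_upwards [ae_restrict_mem measurableSet_Ioo] with r hr
    have hM := (integrable_mean_of_bounded hn hγ hf hx hC hr.1 hr.2.le).2
    have p1 : 0 < m - l - r := by linarith [hr.2]
    have p2 : 0 < m - l + r := by linarith [hr.1]
    have p3 : 0 < (l + m) ^ 2 - r ^ 2 := by nlinarith [hr.1, hr.2]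
    have hr0 := hr.1
    have e : (l ^ 2 - (r - m) ^ 2) * ((r + m) ^ 2 - l ^ 2)
        = -((m - l - r) * ((m - l + r) * ((l + m) ^ 2 - r ^ 2))) := by ring
    -- The base is negative here; the cosine in the real power of a negative number has absolute
    -- value at most one.
    have hk : |((l ^ 2 - (r - m) ^ 2) * ((r + m) ^ 2 - l ^ 2)) ^ s|
        ≤ (m - l - r) ^ s * ((m - l + r) ^ s * ((l + m) ^ 2 - r ^ 2) ^ s) := by
      refine (Real.abs_rpow_le_abs_rpow _ _).trans ?_
      rw [e, abs_neg, abs_of_pos (by positivity), Real.mul_rpow p1.le (by positivity),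
        Real.mul_rpow p2.le p3.le]
    have hC0 : 0 ≤ C := (abs_nonneg _).trans hM
    rw [kernelIntegrand, ← hs, Real.norm_eq_abs, Real.norm_eq_abs, abs_mul, abs_mul,
      abs_of_pos hr0]
    refine le_trans ?_ (le_abs_self _)
    calc _ ≤ (m - l - r) ^ s * ((m - l + r) ^ s * ((l + m) ^ 2 - r ^ 2) ^ s) * C * r := by
          gcongr
      _ = _ := by ring

theorem intervalIntegrable_kernelIntegrand_of_bounded {n : ℕ} (hn : 0 < n) {γ : Fin n → ℝ}
    (hγ : ∀ i, 0 < γ i) {f : (Fin n → ℝ) → ℝ}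
    (hf : AEStronglyMeasurable f (volume.restrict (posOrthant n)))
    (hb : ∀ R : ℝ, ∃ C : ℝ, ∀ z ∈ posOrthant n, ‖z‖ ≤ R → |f z| ≤ C) {x : Fin n → ℝ}
    (hx : x ∈ posOrthant n) {l m : ℝ} (hl : 0 < l) (hm : 0 < m) :
    IntervalIntegrable (kernelIntegrand γ l m f x) volume (l - m) (l + m) := by
  have hconv := iteratedMeanConverges_of_bounded hn hγ hf hb hx hl hm
  have h1 := (kernelIntegrand_formula hn hγ hl hm
    (iteratedMean_eq_integral_angle hn hγ hf hx hl hm hconv).1).1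
  rcases le_or_gt m l with hml | hlm
  · rwa [abs_of_nonneg (by linarith)] at h1
  · rw [abs_of_neg (by linarith), neg_sub] at h1
    have h2 := intervalIntegrable_kernelIntegrand_inner hn hγ hf hb hx hl hlm
    -- Oddness reflects integrability on `[0, m - l]` to `[l - m, 0]`.
    have h3 : IntervalIntegrable (kernelIntegrand γ l m f x) volume (l - m) 0 := by
      have h4 := (h2.comp_sub_left 0).neg
      simp only [zero_sub, sub_zero, neg_sub, Pi.neg_def, kernelIntegrand_neg, neg_neg] at h4
      simpa using h4.symm
    exact (h3.trans h2).trans h1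

end

theorem mainTheorem1 (n : ℕ) (hn : 0 < n) (γ : Fin n → ℝ) (hγ : ∀ i, 0 < γ i)
    (f : (Fin n → ℝ) → ℝ)
    (hf : IntegrableOn (fun x => f x * powWeight γ x) (posOrthant n) volume)
    (hfe : EvenInEach f) :
    -- absolute convergence of the means
    (∀ x ∈ posOrthant n, ∀ᵐ r ∂(volume.restrict (Ioi (0 : ℝ))), MeanConverges γ r f x) ∧
    (∀ l m : ℝ, 0 < l → 0 < m →
      ∀ᵐ x ∂(volume.restrict (posOrthant n)), IteratedMeanConverges γ l m f x) ∧
    (∀ x ∈ posOrthant n, ∀ m : ℝ, 0 < m → ∀ᵐ l ∂(volume.restrict (Ioi (0 : ℝ))),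
      IteratedMeanConverges γ l m f x ∧ IteratedMeanConverges γ m l f x) ∧
    ((∀ R : ℝ, ∃ C : ℝ, ∀ z ∈ posOrthant n, ‖z‖ ≤ R → |f z| ≤ C) →
      ∀ x ∈ posOrthant n, ∀ l m : ℝ, 0 < l → 0 < m →
        IteratedMeanConverges γ l m f x ∧
        IntervalIntegrable (kernelIntegrand γ l m f x) volume (l - m) (l + m)) ∧
    -- the generalized translation formula and the single integral formula
    (∀ x ∈ posOrthant n, ∀ l m : ℝ, 0 < l → 0 < m → IteratedMeanConverges γ l m f x →
      iteratedMean γ l m f x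
        = genTranslation (effDim γ - 1) l (fun r => sphericalMean γ r f x) m ∧
      IntervalIntegrable (kernelIntegrand γ l m f x) volume |l - m| (l + m) ∧
      iteratedMean γ l m f x
        = 2 * Real.Gamma (effDim γ / 2) / (√Real.pi * Real.Gamma ((effDim γ - 1) / 2)) *
            (1 / (2 * l * m) ^ (effDim γ - 2)) *
            ∫ r in |l - m|..(l + m), kernelIntegrand γ l m f x r ∧
      (IntervalIntegrable (kernelIntegrand γ l m f x) volume (l - m) (l + m) →
        iteratedMean γ l m f x
          = 2 * Real.Gamma (effDim γ / 2) / (√Real.pi * Real.Gamma ((effDim γ - 1) / 2)) *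
              (1 / (2 * l * m) ^ (effDim γ - 2)) *
              ∫ r in (l - m)..(l + m), kernelIntegrand γ l m f x r)) ∧
    -- the symmetric form
    (∀ x ∈ posOrthant n, ∀ a b : ℝ, |a| < b →
      IteratedMeanConverges γ ((b - a) / 2) ((b + a) / 2) f x →
      IntervalIntegrable (symmKernelIntegrand γ a b f x) volume |a| b ∧
      iteratedMean γ ((b - a) / 2) ((b + a) / 2) f x
        = Real.Gamma (effDim γ / 2) / (√Real.pi * Real.Gamma ((effDim γ - 1) / 2)) *
            (2 ^ (effDim γ - 1) / (b ^ 2 - a ^ 2) ^ (effDim γ - 2)) *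
            ∫ r in |a|..b, symmKernelIntegrand γ a b f x r ∧
      (IntervalIntegrable (symmKernelIntegrand γ a b f x) volume a b →
        iteratedMean γ ((b - a) / 2) ((b + a) / 2) f x
          = Real.Gamma (effDim γ / 2) / (√Real.pi * Real.Gamma ((effDim γ - 1) / 2)) *
              (2 ^ (effDim γ - 1) / (b ^ 2 - a ^ 2) ^ (effDim γ - 2)) *
              ∫ r in a..b, symmKernelIntegrand γ a b f x r)) := by

  have hfΩ := (integrable_orthantMeasure_iff γ f).2 hf
  have hfm : AEStronglyMeasurable f (volume.restrict (posOrthant n)) :=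
    hfΩ.1.mono_ac (absolutelyContinuous_orthantMeasure γ)
  have hd : 0 < effDim γ - 1 := by linarith [one_lt_effDim hn hγ]
  have single : ∀ x ∈ posOrthant n, ∀ l m : ℝ, 0 < l → 0 < m → IteratedMeanConverges γ l m f x →
      IntervalIntegrable (kernelIntegrand γ l m f x) volume |l - m| (l + m) ∧
      iteratedMean γ l m f x
        = 2 * Real.Gamma (effDim γ / 2) / (√Real.pi * Real.Gamma ((effDim γ - 1) / 2)) *
            (1 / (2 * l * m) ^ (effDim γ - 2)) *
            ∫ r in |l - m|..(l + m), kernelIntegrand γ l m f x r := by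
    intro x hx l m hl hm h
    obtain ⟨h1, h2⟩ := iteratedMean_eq_integral_angle hn hγ hfm hx hl hm h
    rw [h2]
    exact kernelIntegrand_formula hn hγ hl hm h1
  refine ⟨fun x hx => ae_meanConverges hn hγ hfΩ hx,
    fun l m hl hm => ae_iteratedMeanConverges hn hγ hfΩ hl hm, ?_, ?_, ?_, ?_⟩
  · intro x hx m hm
    filter_upwards [ae_iteratedMeanConverges_left hn hγ hfΩ hx hm,
      ae_restrict_mem measurableSet_Ioi] with l hl hl0
    -- Convergence for almost every inner radius follows from that for the outer radius by symmetry.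
    exact ⟨hl, (iteratedMeanConverges_comm hn hγ hfm hx hl0 hm).1 hl⟩
  · intro hb x hx l m hl hm
    exact ⟨iteratedMeanConverges_of_bounded hn hγ hfm hb hx hl hm,
      intervalIntegrable_kernelIntegrand_of_bounded hn hγ hfm hb hx hl hm⟩
  · intro x hx l m hl hm h
    obtain ⟨h1, h2⟩ := single x hx l m hl hm h
    refine ⟨?_, h1, h2, fun h3 => ?_⟩
    · rw [(iteratedMean_eq_integral_angle hn hγ hfm hx hl hm h).2, genTranslation_eq hd]
    · rw [h2, integral_abs_eq_of_odd (kernelIntegrand_neg γ l m f x)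
        (abs_le.2 ⟨by linarith, by linarith⟩) h3]
  · intro x hx a b hab h
    have hab' := abs_lt.1 hab
    obtain ⟨h1, h2⟩ := single x hx _ _ (by linarith [hab'.2]) (by linarith [hab'.1]) h
    have e1 : |(b - a) / 2 - (b + a) / 2| = |a| := by
      rw [← abs_neg a]; congr 1; ring
    have e2 : (b - a) / 2 + (b + a) / 2 = b := by ring
    have hpos : 0 < b ^ 2 - a ^ 2 := by nlinarith [hab'.1, hab'.2]
    -- The halving produces `2^(n+|γ|-2)` in the prefactor, which merges with its factor `2` into
    -- `2^(n+|γ|-1)`.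
    have e3 : 2 * ((b - a) / 2) * ((b + a) / 2) = (b ^ 2 - a ^ 2) / 2 := by ring
    have e4 : (2 : ℝ) ^ (effDim γ - 1) = 2 * 2 ^ (effDim γ - 2) := by
      rw [← Real.rpow_one_add' two_pos.le (by linarith)]; congr 1; ring
    have hI : iteratedMean γ ((b - a) / 2) ((b + a) / 2) f x
        = Real.Gamma (effDim γ / 2) / (√Real.pi * Real.Gamma ((effDim γ - 1) / 2)) *
            (2 ^ (effDim γ - 1) / (b ^ 2 - a ^ 2) ^ (effDim γ - 2)) *
            ∫ r in |a|..b, symmKernelIntegrand γ a b f x r := by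
      rw [h2, e1, e2, e3, symmKernelIntegrand_eq, Real.div_rpow hpos.le two_pos.le, e4]
      have p1 : (0 : ℝ) < 2 ^ (effDim γ - 2) := by positivity
      have p2 : 0 < (b ^ 2 - a ^ 2) ^ (effDim γ - 2) := by positivity
      field_simp
    rw [e1, e2] at h1
    refine ⟨by rwa [symmKernelIntegrand_eq], hI, fun h3 => ?_⟩
    rw [hI, integral_abs_eq_of_odd (fun r => by
      rw [symmKernelIntegrand_eq]; exact kernelIntegrand_neg γ _ _ f x r) hab.le h3]
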